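/- Let $(\Omega,\mathcal F,\mu)$ be a standard probability space, $\theta:\Omega\to\Omega$ an invertible (bi-measurable) ergodic $\mu$-preserving map, $k\ge 2$, and $S=\{s_1,\dots,s_k\}$. A Markov random network (MRN) $\mathcal X=(X_n)_{n\ge 0}$ is a stochastic process in $S\times\Omega$, given by the laws of its trajectories conditional on $X_0=(s_j,\omega)$, such that with $p_{i,j}(n,\omega)=\mathbb P\{X_n=(s_i,\theta^n\omega)\mid X_0=(s_j,\omega)\}$ each $p_{i,j}(n,\cdot)$ is $\mathcal F$-measurable and, for $\mu$-a.e. $\omega$: $\sum_i p_{i,j}(n,\omega)=1$ for all $n,j$, and (Markov property) for all $n$ and $i_0,\dots,i_{n+1}$ one has $\mathbb P\{X_{n+1}=(s_{i_{n+1}},\theta^{n+1}\omega)\mid X_0=(s_{i_0},\omega),\dots,X_n=(s_{i_n},\theta^n\omega)\}=p_{i_{n+1},i_n}(1,\theta^n\omega)$ whenever the condition has positive probability. Write $P_{\mathcal X}(n,\omega)=(p_{i,j}(n,\omega))_{i,j}$. The MRN is a deterministic random network (DRN) if for $\mu$-a.e. $\omega$ all $p_{i,j}(n,\omega)\in\{0,1\}$;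 it then induces maps $T(n,\omega):S\to S$, where $T(n,\omega)(s_j)=s_i$ iff $p_{i,j}(n,\omega)=1$. A DRN is synchronized if there is a measurable $N:\Omega\to\mathbb N$ such that, for $\mu$-a.e. $\omega$, the map $T(n,\omega)$ is constant for all $n\ge N(\omega)$. Let $\mathcal X^0$ be a synchronized DRN with $P^0=P_{\mathcal X^0}$, and let $\{\mathcal X^\varepsilon\}_{\varepsilon\ge 0}$ be a $C^m$-Markov perturbation of $\mathcal X^0$ ($m\ge 1$). That is, each $\mathcal X^\varepsilon$ is an MRN (with the $\mu$-null set on which its defining properties may fail common to all $\varepsilon\ge0$); for $\mu$-a.e. $\omega$, $|P_{\mathcal X^\varepsilon}(1,\omega)-P^0(1,\omega)|\le\varepsilon$ for all $\varepsilon\ge 0$, where $|\cdot|$ is the matrix norm induced by the $\ell^1$-norm; and for some $\varepsilon_0>0$ and $\mu$-a.e. $\omega$, the map $\varepsilon\mapsto P_{\mathcal X^\varepsilon}(1,\omega)$ is $C^m$ on $[0,\varepsilon_0]$. Then $\mathcal X^0$ has a synchronization index, that is, a measurable $J:\Omega\to\{1,\dots,k\}$ with $P^0(n,\omega)e_{J(\omega)}=e_{J(\theta^n\omega)}$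 for all $n\ge0$ and $\mu$-a.e. $\omega$, and a pull-back synchronization time, that is, a measurable $N^-:\Omega\to\mathbb N$ such that for $\mu$-a.e. $\omega$, $P^0(n,\theta^{-n}\omega)e_j=e_{J(\omega)}$ for all $j$ and all $n\ge N^-(\omega)$. For any such $J$ and $N^-$, with $P^{(1)}(n,\omega)=\frac{d}{d\varepsilon}P_{\mathcal X^\varepsilon}(n,\omega)|_{\varepsilon=0}$ (one-sided derivative), let $$d(\omega)=P^{(1)}(1,\omega)e_{J(\omega)},\qquad q^{(1)}(\omega)=P^{(1)}\bigl(N^-(\omega),\theta^{-N^-(\omega)}\omega\bigr)e_{J(\theta^{-N^-(\omega)}\omega)},\qquad \Omega^{(1)}=\{q^{(1)}=0\}.$$ If $\mu(\{\omega: d(\theta^{-1}\omega)=0\})<1$, then $\mu(\Omega^{(1)})<1$, and the following holds with $a=\mu(\Omega^{(1)})$ if $\mu(\Omega^{(1)})>0$, and with every $a\in(0,1)$ if $\mu(\Omega^{(1)})=0$. For every sufficiently small $\delta>0$ there exist $\varepsilon_\delta,b_\delta,c_\delta>0$ and $E_\delta,F_\delta:\Omega\to 2^{\mathbb N}$ such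 that for $\mu$-a.e. $\omega$: (i) $E_\delta(\omega)$ and $F_\delta(\omega)$ are disjoint, have positive lower density, and $$\liminf_{n\to\infty}\frac{\#(E_\delta(\omega)\cap\{1,\dots,n\})}{n}>a-\delta,\qquad \liminf_{n\to\infty}\frac{\#(F_\delta(\omega)\cap\{1,\dots,n\})}{n}>1-a-\delta;$$ (ii) for all $0\le\varepsilon<\varepsilon_\delta$ and any two independent copies $\mathcal X,\mathcal Y$ of $\mathcal X^\varepsilon$ (with arbitrary initial distributions on the fibre $S\times\{\omega\}$), $$\mathbb P\{X_n=Y_n\mid X_0,Y_0\in S\times\{\omega\}\}\ge 1-\varepsilon\, b_\delta\quad\forall n\in E_\delta(\omega),$$ $$\mathbb P\{X_n\ne Y_n\mid X_0,Y_0\in S\times\{\omega\}\}\ge \varepsilon\, c_\delta\quad\forall n\in F_\delta(\omega).$$ -/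

import Mathlib

open MeasureTheory ProbabilityTheory Filter Set
open scoped Matrix NNReal

universe u w

/-- The three defining properties of a Markov random network, at one point `ω` of the base.
Here `law j ω` is the law of the trajectory `(X_n)` in `Fin k × Ω` conditional on
`X_0 = (j, ω)`. -/
structure IsMarkovAt {Ω : Type*} [MeasurableSpace Ω] {k : ℕ} (θ : Ω ≃ᵐ Ω)
    (law : Fin k → Ω → Measure (ℕ → Fin k × Ω)) (ω : Ω) : Prop where
  /-- the trajectory starts at the state it is conditioned on -/
  start : ∀ j, law j ω {x | x 0 = (j, ω)} = 1
  /-- stochastic over `θ`: at time `n` the trajectory is in the fibre over `θ^n ω` -/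
  stochastic : ∀ (n : ℕ) (j : Fin k), ∑ i, law j ω {x | x n = (i, θ^[n] ω)} = 1
  /-- Markov property over `θ`, multiplied out by the probability of the past -/
  markov : ∀ (n : ℕ) (s : ℕ → Fin k),
    law (s 0) ω {x | ∀ t ≤ n + 1, x t = (s t, θ^[t] ω)} =
      law (s n) (θ^[n] ω) {x | x 1 = (s (n + 1), θ^[n + 1] ω)} *
        law (s 0) ω {x | ∀ t ≤ n, x t = (s t, θ^[t] ω)}

/-- A Markov random network with state set `Fin k` over the metric dynamical system
`(Ω, μ, θ)`, given by the laws of its trajectories conditional on `X_0 = (j, ω)`. -/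
structure MRN {Ω : Type*} [MeasurableSpace Ω] (k : ℕ) (θ : Ω ≃ᵐ Ω) (μ : Measure Ω) where
  law : Fin k → Ω → Measure (ℕ → Fin k × Ω)
  isProbabilityMeasure_law : ∀ j ω, IsProbabilityMeasure (law j ω)
  measurable_law : ∀ (n : ℕ) (i j : Fin k),
    Measurable fun ω => law j ω {x | x n = (i, θ^[n] ω)}
  ae_isMarkovAt : ∀ᵐ ω ∂μ, IsMarkovAt θ law ω

namespace MRN

variable {Ω : Type u} [MeasurableSpace Ω] {k : ℕ} {θ : Ω ≃ᵐ Ω} {μ : Measure Ω}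

/-- The transition cocycle: the `(i, j)` entry is `Prob(X_n = (i, θ^n ω) | X_0 = (j, ω))`. -/
noncomputable def trans (X : MRN k θ μ) (n : ℕ) (ω : Ω) : Matrix (Fin k) (Fin k) ℝ :=
  Matrix.of fun i j => (X.law j ω).real {x | x n = (i, θ^[n] ω)}

/-- Deterministic random networks: the transition cocycle has entries in `{0, 1}`. -/
def IsDeterministic (X : MRN k θ μ) : Prop :=
  ∀ᵐ ω ∂μ, ∀ (n : ℕ) (i j : Fin k), X.trans n ω i j = 0 ∨ X.trans n ω i j = 1

open Classical in
/-- The map `T(n, ω)` on states of a deterministic random network: `T(n, ω) j = i` iff the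
`(i, j)` entry of the transition cocycle is `1`. (The value `j` is a default, which is used for a
null set of `ω` only.) -/
noncomputable def stateMap (X : MRN k θ μ) (n : ℕ) (ω : Ω) (j : Fin k) : Fin k :=
  if h : ∃ i, X.trans n ω i j = 1 then h.choose else j

/-- Synchronization of a deterministic random network. -/
def IsSynchronized (X : MRN k θ μ) : Prop :=
  ∃ N : Ω → ℕ, Measurable N ∧
    ∀ᵐ ω ∂μ, ∀ i j : Fin k, ∀ n ≥ N ω, X.stateMap n ω i = X.stateMap n ω j

/-- `J` is a synchronization index: `P(n, ω) e_{J(ω)} = e_{J(θ^n ω)}`. -/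
def IsSyncIndex (X : MRN k θ μ) (J : Ω → Fin k) : Prop :=
  Measurable J ∧ ∀ᵐ ω ∂μ, ∀ n : ℕ,
    X.trans n ω *ᵥ Pi.single (J ω) 1 = Pi.single (J (θ^[n] ω)) 1

/-- `N` is a pull-back synchronization time with respect to the synchronization index `J`:
`P(n, θ^{-n} ω) e_j = e_{J(ω)}` for all `j` and all `n ≥ N(ω)`. -/
def IsPullbackSyncTime (X : MRN k θ μ) (J : Ω → Fin k) (N : Ω → ℕ) : Prop :=
  Measurable N ∧ ∀ᵐ ω ∂μ, ∀ j : Fin k, ∀ n ≥ N ω,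
    X.trans n (θ.symm^[n] ω) *ᵥ Pi.single j 1 = Pi.single (J ω) 1

/-- The norm on matrices that is induced by the `ℓ¹` norm on vectors. -/
noncomputable def oneNorm (A : Matrix (Fin k) (Fin k) ℝ) : ℝ := ⨆ j, ∑ i, |A i j|

/-- `(X ε)_{ε ≥ 0}` is a Markov perturbation of `X₀`. The exceptional null set is common to all
`ε ≥ 0`. Only the members with `ε ≥ 0` matter. -/
def IsMarkovPerturbation (X : ℝ → MRN k θ μ) (X₀ : MRN k θ μ) : Prop :=
  ∀ᵐ ω ∂μ, ∀ ε : ℝ, 0 ≤ ε →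
    IsMarkovAt θ (X ε).law ω ∧ oneNorm ((X ε).trans 1 ω - X₀.trans 1 ω) ≤ ε

/-- The perturbation is `C^m`: for some `ε₀ > 0` and almost every `ω`, the one-step transition
matrix is a `C^m` function of `ε` on `[0, ε₀]`. -/
def IsSmoothPerturbation (X : ℝ → MRN k θ μ) (m : ℕ) : Prop :=
  ∃ ε₀ : ℝ, 0 < ε₀ ∧ ∀ᵐ ω ∂μ, ∀ i j : Fin k,
    ContDiffOn ℝ m (fun ε => (X ε).trans 1 ω i j) (Icc 0 ε₀)

/-- The (one-sided) derivative at `ε = 0` of the transition cocycles. -/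
noncomputable def transDeriv (X : ℝ → MRN k θ μ) (n : ℕ) (ω : Ω) : Matrix (Fin k) (Fin k) ℝ :=
  Matrix.of fun i j => derivWithin (fun ε => (X ε).trans n ω i j) (Ici 0) 0

/-- The first-order one-step probability dissipation `d(ω)`. -/
noncomputable def dissipation (X : ℝ → MRN k θ μ) (J : Ω → Fin k) (ω : Ω) : Fin k → ℝ :=
  transDeriv X 1 ω *ᵥ Pi.single (J ω) 1

/-- The first-order coefficient `q⁽¹⁾(ω)` of the invariant distribution, computed from a
synchronization index `J` and a pull-back synchronization time `N`. -/
noncomputable def firstCoeff (X : ℝ → MRN k θ μ) (J : Ω → Fin k) (N : Ω → ℕ) (ω : Ω) :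
    Fin k → ℝ :=
  transDeriv X (N ω) (θ.symm^[N ω] ω) *ᵥ Pi.single (J (θ.symm^[N ω] ω)) 1

/-- The set `Ω⁽¹⁾ = {q⁽¹⁾ = 0}` of first-order degeneracy. -/
def degenerateSet (X : ℝ → MRN k θ μ) (J : Ω → Fin k) (N : Ω → ℕ) : Set Ω :=
  {ω | firstCoeff X J N ω = 0}

/-- Under the probability measure `Q`, the process `ξ` is a copy of `X` conditional on starting in
the fibre over `ω`; its initial distribution `u` on the fibre is arbitrary. -/
def IsCopyOver (X : MRN k θ μ) (ω : Ω) {W : Type*} [MeasurableSpace W] (Q : Measure W)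
    (ξ : ℕ → W → Fin k × Ω) : Prop :=
  (∀ n, Measurable (ξ n)) ∧ ∃ u : Fin k → ℝ≥0, ∑ j, u j = 1 ∧
    Q.map (fun w n => ξ n w) = ∑ j, u j • X.law j ω

/-- The lower density of a set of positive integers. -/
noncomputable def lowerDensity (A : Set ℕ) : ℝ :=
  liminf (fun n : ℕ => ((A ∩ Icc 1 n).ncard : ℝ) / n) atTop

/-- Alternation, along almost every `ω`, of high-probability synchronization and low-probability
desynchronization, with densities `a` and `1 - a` and of order `ε ^ ℓ`. -/
def HasAlternatingPattern (X : ℝ → MRN k θ μ) (a : ℝ) (ℓ : ℕ) : Prop :=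
  ∃ δ₀ : ℝ, 0 < δ₀ ∧ ∀ δ : ℝ, 0 < δ → δ < δ₀ →
    ∃ εδ b c : ℝ, 0 < εδ ∧ 0 < b ∧ 0 < c ∧ ∃ E F : Ω → Set ℕ, ∀ᵐ ω ∂μ,
      (Disjoint (E ω) (F ω) ∧
        0 < lowerDensity (E ω) ∧ 0 < lowerDensity (F ω) ∧
        a - δ < lowerDensity (E ω) ∧ 1 - a - δ < lowerDensity (F ω)) ∧
      ∀ ε : ℝ, 0 ≤ ε → ε < εδ →
        ∀ (W : Type w) [MeasurableSpace W] (Q : Measure W) [IsProbabilityMeasure Q]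
          (ξ η : ℕ → W → Fin k × Ω),
          IsCopyOver (X ε) ω Q ξ → IsCopyOver (X ε) ω Q η →
          IndepFun (fun w n => ξ n w) (fun w n => η n w) Q →
          (∀ n ∈ E ω, 1 - ε ^ ℓ * b ≤ Q.real {w | ξ n w = η n w}) ∧
          (∀ n ∈ F ω, ε ^ ℓ * c ≤ Q.real {w | ξ n w ≠ η n w})

end MRN

/-!
Write `P_ε(n, ω)` for the transition cocycle of `X ε`, and `P(n, ω)` for that of the deterministic
network. By the Chapman–Kolmogorov equation (`IsMarkovAt.law_succ`) these are cocycles of stochastic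
matrices, so the law at time `n` of any copy over `ω` can be read off at `ω' = θ^n ω` as
`P_ε(m, θ^{-m} ω')` applied to some probability vector, for every `m ≤ n`.

*Pull-back synchronization* (`exists_isSyncIndex_isPullbackSyncTime`). The set of `ω` for which
some `P(m, θ^{-m} ω)` is constant has positive measure and is mapped into itself by `θ`. By
ergodicity it has full measure, and the common value is the synchronization index.

*Synchronization.* A deterministic path of length `m` is followed with probability at least
`1 - m ε` (`one_sub_le_trans`). If `N(ω') ≤ M ≤ n`, then each copy is therefore in the state
`J(ω')` at time `n` with probability at least `1 - M ε`, and two copies meet with probability at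
least `1 - 2 M ε`.

*Desynchronization.* Let `f(ε)` be the probability that the network, started at `θ^{-N(ω')} ω'` in
its synchronized state, is not in the state `J(ω')` at `ω'` (`escapeProb`). Since `f ≥ 0` and
`f(0) = 0`, it is of order `ε` exactly if the first-order coefficient at `ω'` is nonzero
(`exists_mem_desyncSet_iff`). If in addition the pull-back time at `θ^{-N(ω')} ω'` is at most `M`,
then an arbitrary initial distribution has been synchronized, up to a probability `M ε`, by the
time the orbit gets there. Hence one copy is outside of `J(ω')` with a probability of order `ε`,
while the other one is in it with probability at least `1 / 2` (`sync_and_desync`).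

*Nondegeneracy.* The first-order coefficient `q` does not depend on the pull-back time and satisfies
`q(θ ω) = d(ω) + P(1, ω) q(ω)`, so `q = 0` almost everywhere would force `d = 0` almost everywhere
(`dissipation_eq_zero`).

*Densities.* The lower half of the pointwise ergodic theorem, which follows from the maximal ergodic
theorem (`Ergodic.ae_exists_le_ncard_visits`), gives the density of the visits to the two good
sets, whose measures tend to those of `{q = 0}` and `{q ≠ 0}` as `M → ∞`. If `{q = 0}` is a null
set, then almost all times are good for both purposes, and they are shared out by a Beatty set of
times of density `a` (`beattySet`).
-/

/-! ### The transition cocycle -/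

section MarkovAt

variable {Ω : Type*} [MeasurableSpace Ω] [MeasurableSingletonClass Ω] {k : ℕ} {θ : Ω ≃ᵐ Ω}
  {law : Fin k → Ω → Measure (ℕ → Fin k × Ω)}

lemma measurableSet_eval_eq (n : ℕ) (p : Fin k × Ω) :
    MeasurableSet {x : ℕ → Fin k × Ω | x n = p} :=
  (measurable_pi_apply (X := fun _ : ℕ => Fin k × Ω) n) (measurableSet_singleton p)

variable [∀ j ω, IsProbabilityMeasure (law j ω)] {ω : Ω}

lemma IsMarkovAt.ae_mem_fibre (h : IsMarkovAt θ law ω) (j : Fin k) :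
    ∀ᵐ x ∂law j ω, ∀ n, x n = ((x n).1, θ^[n] ω) := by
  rw [ae_all_iff]
  intro n
  have hU : (⋃ i : Fin k, {x : ℕ → Fin k × Ω | x n = (i, θ^[n] ω)}) ∈ ae (law j ω) := by
    rw [mem_ae_iff_prob_eq_one (.iUnion fun i => measurableSet_eval_eq n _),
      measure_iUnion _ fun i => measurableSet_eval_eq n _, tsum_fintype, h.stochastic n j]
    intro i i' hii'
    refine disjoint_left.2 fun x hx hx' => hii' ?_
    have : (i, θ^[n] ω) = (i', θ^[n] ω) := hx.symm.trans hx'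
    exact congrArg Prod.fst this
  filter_upwards [hU] with x hx
  obtain ⟨i, hi⟩ := mem_iUnion.1 hx
  rw [show x n = (i, θ^[n] ω) from hi]

lemma IsMarkovAt.ae_zero_eq (h : IsMarkovAt θ law ω) (j : Fin k) :
    ∀ᵐ x ∂law j ω, x 0 = (j, ω) :=
  (mem_ae_iff_prob_eq_one (measurableSet_eval_eq 0 _)).2 (h.start j)

/-- The Chapman–Kolmogorov equation: the Markov property is summed over all pasts. -/
theorem IsMarkovAt.law_succ (h : IsMarkovAt θ law ω) (n : ℕ) (i j : Fin k) :
    law j ω {x | x (n + 1) = (i, θ^[n + 1] ω)} =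
      ∑ l, law l (θ^[n] ω) {x | x 1 = (i, θ^[n + 1] ω)} * law j ω {x | x n = (l, θ^[n] ω)} := by
  classical
  -- the states up to time `n`, a random variable with finitely many values
  let past : (ℕ → Fin k × Ω) → (Fin (n + 1) → Fin k) := fun x t => (x t).1
  have hpast : Measurable past :=
    measurable_pi_lambda _ fun t => measurable_fst.comp (measurable_pi_apply _)
  have hsum : ∀ A : Set (ℕ → Fin k × Ω),
      law j ω A = ∑ s : Fin (n + 1) → Fin k, law j ω (past ⁻¹' {s} ∩ A) := by
    intro A
    have := sum_measure_preimage_singleton (μ := (law j ω).restrict A) Finset.univ (f := past)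
      (fun s _ => hpast (measurableSet_singleton s))
    simp only [Finset.coe_univ, preimage_univ, Measure.restrict_apply_univ] at this
    rw [← this]
    exact Finset.sum_congr rfl fun s _ =>
      Measure.restrict_apply (hpast (measurableSet_singleton s))
  have hpres : ∀ l, law j ω {x | x n = (l, θ^[n] ω)} =
      ∑ s : Fin (n + 1) → Fin k, if s (Fin.last n) = l then law j ω (past ⁻¹' {s}) else 0 := by
    intro l
    rw [hsum]
    refine Finset.sum_congr rfl fun s _ => ?_
    split_ifs with hs
    · refine measure_congr (eventuallyEq_set.2 ?_)
      filter_upwards [h.ae_mem_fibre j] with x hx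
      refine ⟨fun hx' => hx'.1, fun hx' => ⟨hx', ?_⟩⟩
      have h1 : past x (Fin.last n) = l := by rw [show past x = s from hx', hs]
      rw [mem_ofPred_eq, hx n]
      exact congrArg₂ Prod.mk h1 rfl
    · rw [show past ⁻¹' {s} ∩ {x | x n = (l, θ^[n] ω)} = ∅ from ?_, measure_empty]
      refine eq_empty_of_forall_notMem fun x hx => hs ?_
      rw [← show past x = s from hx.1]
      exact congrArg Prod.fst (show x n = (l, θ^[n] ω) from hx.2)
  have hstep : ∀ s : Fin (n + 1) → Fin k,
      law j ω (past ⁻¹' {s} ∩ {x | x (n + 1) = (i, θ^[n + 1] ω)}) =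
        law (s (Fin.last n)) (θ^[n] ω) {x | x 1 = (i, θ^[n + 1] ω)} * law j ω (past ⁻¹' {s}) := by
    intro s
    by_cases hs0 : s 0 = j
    · subst hs0
      let e : ℕ → Fin k := fun t => if ht : t < n + 1 then s ⟨t, ht⟩ else i
      have he0 : e 0 = s 0 := by simp [e]
      have hen : e n = s (Fin.last n) := by simp [e, Fin.last]
      have hen1 : e (n + 1) = i := by simp [e]
      have hm := h.markov n e
      rw [he0, hen, hen1] at hm
      have hiff : ∀ x : ℕ → Fin k × Ω, (∀ n, x n = ((x n).1, θ^[n] ω)) →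
          (past x = s ↔ ∀ t ≤ n, x t = (e t, θ^[t] ω)) := by
        intro x hx
        constructor
        · rintro hp t ht
          rw [hx t]
          refine congrArg₂ Prod.mk ?_ rfl
          have : e t = s ⟨t, by omega⟩ := dif_pos (by omega)
          rw [this, ← hp]
        · intro hp
          funext t
          have : e t = s t := dif_pos t.2
          rw [← this]
          exact congrArg Prod.fst (hp t (by omega))
      have hA : (past ⁻¹' {s} : Set _) =ᵐ[law (s 0) ω] {x | ∀ t ≤ n, x t = (e t, θ^[t] ω)} := by
        refine eventuallyEq_set.2 ?_
        filter_upwards [h.ae_mem_fibre (s 0)] with x hx using hiff x hx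
      have hB : (past ⁻¹' {s} ∩ {x | x (n + 1) = (i, θ^[n + 1] ω)} : Set _) =ᵐ[law (s 0) ω]
          {x | ∀ t ≤ n + 1, x t = (e t, θ^[t] ω)} := by
        refine eventuallyEq_set.2 ?_
        filter_upwards [h.ae_mem_fibre (s 0)] with x hx
        constructor
        · rintro ⟨h1, h2⟩ t ht
          rcases Nat.le_succ_iff.1 ht with ht | rfl
          · exact (hiff x hx).1 h1 t ht
          · rw [hen1]; exact h2
        · intro hx'
          refine ⟨(hiff x hx).2 fun t ht => hx' t (by omega), ?_⟩
          have := hx' (n + 1) le_rfl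
          rwa [hen1] at this
      rw [measure_congr hA, measure_congr hB, hm]
    · have h0 : law j ω (past ⁻¹' {s}) = 0 := by
        refine measure_eq_zero_iff_ae_notMem.2 ?_
        filter_upwards [h.ae_zero_eq j] with x hx hxs
        apply hs0
        rw [← show past x = s from hxs]
        exact congrArg Prod.fst hx
      rw [h0, mul_zero]
      exact measure_mono_null inter_subset_left h0
  rw [hsum, Finset.sum_congr rfl fun s _ => hstep s]
  simp_rw [hpres, Finset.mul_sum]
  rw [Finset.sum_comm]
  refine Finset.sum_congr rfl fun s _ => ?_
  simp [mul_ite]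

end MarkovAt

namespace MRN

variable {Ω : Type u} [MeasurableSpace Ω] {k : ℕ} {θ : Ω ≃ᵐ Ω} {μ : Measure Ω}

instance (X : MRN k θ μ) (j : Fin k) (ω : Ω) : IsProbabilityMeasure (X.law j ω) :=
  X.isProbabilityMeasure_law j ω

lemma trans_nonneg (X : MRN k θ μ) (n : ℕ) (ω : Ω) (i j : Fin k) : 0 ≤ X.trans n ω i j :=
  measureReal_nonneg

lemma trans_le_one (X : MRN k θ μ) (n : ℕ) (ω : Ω) (i j : Fin k) : X.trans n ω i j ≤ 1 :=
  measureReal_le_one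

lemma measurable_trans (X : MRN k θ μ) (n : ℕ) (i j : Fin k) :
    Measurable fun ω => X.trans n ω i j :=
  (X.measurable_law n i j).ennreal_toReal

/-- The Markov property holds along the whole forward orbit of `ω`. -/
def MarkovAlong (X : MRN k θ μ) (ω : Ω) : Prop := ∀ n : ℕ, IsMarkovAt θ X.law (θ^[n] ω)

lemma MarkovAlong.iterate {X : MRN k θ μ} {ω : Ω} (h : X.MarkovAlong ω) (m : ℕ) :
    X.MarkovAlong (θ^[m] ω) := fun n => by
  rw [← Function.iterate_add_apply]
  exact h _

lemma MarkovAlong.sum_trans {X : MRN k θ μ} {ω : Ω} (h : X.MarkovAlong ω) (n : ℕ) (j : Fin k) :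
    ∑ i, X.trans n ω i j = 1 := by
  have := congrArg ENNReal.toReal ((h 0).stochastic n j)
  rw [ENNReal.toReal_sum fun _ _ => measure_ne_top _ _, ENNReal.toReal_one] at this
  exact this

/-- A column with an entry `1` is a unit vector. -/
lemma MarkovAlong.trans_eq_ite {X : MRN k θ μ} {ω : Ω} (h : X.MarkovAlong ω) {n : ℕ}
    {i j : Fin k} (hij : X.trans n ω i j = 1) (l : Fin k) :
    X.trans n ω l j = if l = i then 1 else 0 := by
  split_ifs with hl
  · rw [hl, hij]
  · have hle : X.trans n ω l j + X.trans n ω i j ≤ 1 := by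
      rw [← h.sum_trans n j, ← Finset.sum_pair hl (f := fun i => X.trans n ω i j)]
      exact Finset.sum_le_sum_of_subset_of_nonneg (Finset.subset_univ _)
        fun i _ _ => X.trans_nonneg n ω i j
    linarith [X.trans_nonneg n ω l j]

lemma MarkovAlong.exists_trans_eq_one {X : MRN k θ μ} {ω : Ω} (h : X.MarkovAlong ω) {n : ℕ}
    {j : Fin k} (hdet : ∀ i, X.trans n ω i j = 0 ∨ X.trans n ω i j = 1) :
    ∃ i, X.trans n ω i j = 1 := by
  by_contra! hne
  have := h.sum_trans n j
  rw [Finset.sum_eq_zero fun i _ => (hdet i).resolve_right (hne i)] at this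
  exact zero_ne_one this

lemma MarkovAlong.trans_zero {X : MRN k θ μ} {ω : Ω} (h : X.MarkovAlong ω) :
    X.trans 0 ω = 1 := by
  ext i j
  have hj : X.trans 0 ω j j = 1 := by
    have := congrArg ENNReal.toReal ((h 0).start j)
    rw [ENNReal.toReal_one] at this
    exact this
  rw [h.trans_eq_ite hj, Matrix.one_apply]

lemma MarkovAlong.trans_mulVec_mem {X : MRN k θ μ} {ω : Ω} (h : X.MarkovAlong ω) (n : ℕ)
    {u : Fin k → ℝ} (hu : u ∈ stdSimplex ℝ (Fin k)) :
    X.trans n ω *ᵥ u ∈ stdSimplex ℝ (Fin k) := by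
  refine ⟨fun i => ?_, ?_⟩
  · simp only [Matrix.mulVec, dotProduct]
    exact Finset.sum_nonneg fun j _ => mul_nonneg (X.trans_nonneg n ω i j) (hu.1 j)
  simp only [Matrix.mulVec, dotProduct]
  rw [Finset.sum_comm, ← hu.2]
  refine Finset.sum_congr rfl fun j _ => ?_
  rw [← Finset.sum_mul, h.sum_trans, one_mul]

lemma abs_apply_le_oneNorm (A : Matrix (Fin k) (Fin k) ℝ) (i j : Fin k) :
    |A i j| ≤ oneNorm A :=
  (Finset.single_le_sum (f := fun i => |A i j|) (fun _ _ => abs_nonneg _)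
    (Finset.mem_univ i)).trans (le_ciSup (f := fun j => ∑ i, |A i j|) (finite_range _).bddAbove j)

lemma measureReal_inter_eq {W : Type w} [MeasurableSpace W] {Q : Measure W}
    {ξ η : ℕ → W → Fin k × Ω} (hind : IndepFun (fun w n => ξ n w) (fun w n => η n w) Q) (n : ℕ)
    {A B : Set (Fin k × Ω)}
    (hA : MeasurableSet A) (hB : MeasurableSet B) :
    Q.real (ξ n ⁻¹' A ∩ η n ⁻¹' B) = Q.real (ξ n ⁻¹' A) * Q.real (η n ⁻¹' B) := by
  have h1 : IndepFun (ξ n) (η n) Q :=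
    hind.comp (measurable_pi_apply n) (measurable_pi_apply n)
  rw [measureReal_def, h1.measure_inter_preimage_eq_mul _ _ hA hB, ENNReal.toReal_mul]
  rfl

variable [MeasurableSingletonClass Ω]

lemma MarkovAlong.trans_succ {X : MRN k θ μ} {ω : Ω} (h : X.MarkovAlong ω) (n : ℕ) :
    X.trans (n + 1) ω = X.trans 1 (θ^[n] ω) * X.trans n ω := by
  ext i j
  have := congrArg ENNReal.toReal ((h 0).law_succ n i j)
  rw [ENNReal.toReal_sum fun _ _ => ENNReal.mul_ne_top (measure_ne_top _ _) (measure_ne_top _ _)]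
    at this
  simp only [ENNReal.toReal_mul] at this
  rw [Matrix.mul_apply]
  simp only [trans, Matrix.of_apply, measureReal_def, Function.iterate_one,
    ← Function.iterate_succ_apply' θ]
  exact this

/-- The cocycle property of the transition matrices. -/
lemma MarkovAlong.trans_add {X : MRN k θ μ} {ω : Ω} (h : X.MarkovAlong ω) (m n : ℕ) :
    X.trans (m + n) ω = X.trans m (θ^[n] ω) * X.trans n ω := by
  induction m with
  | zero => rw [Nat.zero_add, (h.iterate n).trans_zero, Matrix.one_mul]
  | succ m ih =>
    rw [Nat.add_right_comm, h.trans_succ, ih, (h.iterate n).trans_succ, Matrix.mul_assoc,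
      ← Function.iterate_add_apply]


/-- If the perturbed one-step transition probabilities differ by at most `ε` from those of a
deterministic network, then a deterministic path of length `m` is followed with probability at
least `1 - m ε`. -/
lemma one_sub_le_trans {X X₀ : MRN k θ μ} {ω : Ω} {ε : ℝ} (h : X.MarkovAlong ω)
    (h₀ : X₀.MarkovAlong ω) (hdet : ∀ n i j, X₀.trans n ω i j = 0 ∨ X₀.trans n ω i j = 1)
    (hclose : ∀ t i j, |X.trans 1 (θ^[t] ω) i j - X₀.trans 1 (θ^[t] ω) i j| ≤ ε)
    (m : ℕ) {i l : Fin k} (hil : X₀.trans m ω i l = 1) : 1 - m * ε ≤ X.trans m ω i l := by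
  induction m generalizing i with
  | zero =>
    rw [h₀.trans_zero] at hil
    rw [h.trans_zero, hil]
    simp
  | succ m ih =>
    obtain ⟨l', hl'⟩ := h₀.exists_trans_eq_one (fun i => hdet m i l)
    have h1 : X₀.trans 1 (θ^[m] ω) i l' = 1 := by
      rw [h₀.trans_succ, Matrix.mul_apply] at hil
      simpa [h₀.trans_eq_ite hl'] using hil
    have h2 := (abs_le.1 (hclose m i l')).1
    rw [h1] at h2
    have h3 := ih hl'
    have h4 : X.trans 1 (θ^[m] ω) i l' * X.trans m ω l' l ≤ X.trans (m + 1) ω i l := by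
      rw [h.trans_succ, Matrix.mul_apply]
      exact Finset.single_le_sum (f := fun a => X.trans 1 (θ^[m] ω) i a * X.trans m ω a l)
        (fun a _ => mul_nonneg (X.trans_nonneg _ _ _ _) (X.trans_nonneg _ _ _ _))
        (Finset.mem_univ l')
    push_cast
    nlinarith [X.trans_le_one 1 (θ^[m] ω) i l', X.trans_le_one m ω l' l]

section Copy

variable {X : MRN k θ μ} {ω : Ω} {W : Type w} [MeasurableSpace W] {Q : Measure W}
  {ξ η : ℕ → W → Fin k × Ω}

/-- The one-dimensional distributions of a copy are the images of its initial distribution under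
the transition matrices. -/
lemma IsCopyOver.exists_measureReal_eq (h : IsCopyOver X ω Q ξ) :
    ∃ u ∈ stdSimplex ℝ (Fin k), ∀ (n : ℕ) (i : Fin k),
      Q.real {w | ξ n w = (i, θ^[n] ω)} = (X.trans n ω *ᵥ u) i := by
  obtain ⟨hξ, u, hu, hQ⟩ := h
  refine ⟨fun j => u j, ⟨fun j => (u j).2, by simpa using congrArg NNReal.toReal hu⟩, fun n i => ?_⟩
  have hmap : Q {w | ξ n w = (i, θ^[n] ω)} =
      Q.map (fun w n => ξ n w) {x | x n = (i, θ^[n] ω)} :=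
    (Measure.map_apply (measurable_pi_lambda _ hξ) (measurableSet_eval_eq n _)).symm
  rw [measureReal_def, hmap, hQ, Measure.finsetSum_apply,
    ENNReal.toReal_sum fun j _ => measure_ne_top _ _]
  simp only [Matrix.mulVec, dotProduct, Measure.smul_apply]
  refine Finset.sum_congr rfl fun j _ => ?_
  rw [ENNReal.smul_def, smul_eq_mul, ENNReal.toReal_mul, mul_comm]
  rfl

variable [IsProbabilityMeasure Q]

lemma le_measureReal_eq
    (hind : IndepFun (fun w n => ξ n w) (fun w n => η n w) Q) (n : ℕ) (p : Fin k × Ω) :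
    Q.real {w | ξ n w = p} + Q.real {w | η n w = p} - 1 ≤ Q.real {w | ξ n w = η n w} := by
  have h := measureReal_inter_eq hind n (measurableSet_singleton p)
    (measurableSet_singleton p)
  have hsub : Q.real (ξ n ⁻¹' {p} ∩ η n ⁻¹' {p}) ≤ Q.real {w | ξ n w = η n w} :=
    measureReal_mono fun w hw => (show ξ n w = p from hw.1).trans (show η n w = p from hw.2).symm
  have h1 : Q.real (ξ n ⁻¹' {p}) ≤ 1 := measureReal_le_one
  have h2 : Q.real (η n ⁻¹' {p}) ≤ 1 := measureReal_le_one
  change Q.real (ξ n ⁻¹' {p}) + Q.real (η n ⁻¹' {p}) - 1 ≤ _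
  nlinarith

lemma le_measureReal_ne (hξ : ∀ n, Measurable (ξ n))
    (hind : IndepFun (fun w n => ξ n w) (fun w n => η n w) Q) (n : ℕ) (p : Fin k × Ω) :
    (1 - Q.real {w | ξ n w = p}) * Q.real {w | η n w = p} ≤ Q.real {w | ξ n w ≠ η n w} := by
  have h := measureReal_inter_eq hind n (measurableSet_singleton p).compl
    (measurableSet_singleton p)
  have hc : Q.real (ξ n ⁻¹' {p}ᶜ) = 1 - Q.real {w | ξ n w = p} :=
    probReal_compl_eq_one_sub (hξ n (measurableSet_singleton p))
  rw [← hc]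
  refine h.symm.trans_le (measureReal_mono fun w hw he => hw.1 ?_)
  exact he.trans hw.2

end Copy

end MRN

/-! ### The lower half of the pointwise ergodic theorem -/

/-- The running maximum `max (S_0 g, …, S_n g)` of the Birkhoff sums of `g`, through the recursion
`M_{n+1} = max (0, g + M_n ∘ θ)`. -/
noncomputable def birkhoffMax {α : Type*} (θ : α → α) (g : α → ℝ) : ℕ → α → ℝ
  | 0 => fun _ => 0
  | n + 1 => fun x => max 0 (g x + birkhoffMax θ g n (θ x))

section Birkhoff

variable {α : Type*} {θ : α → α} {g : α → ℝ}

lemma birkhoffMax_nonneg (n : ℕ) (x : α) : 0 ≤ birkhoffMax θ g n x := by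
  cases n
  · exact le_rfl
  · exact le_max_left _ _

lemma birkhoffMax_le_succ (n : ℕ) (x : α) :
    birkhoffMax θ g n x ≤ birkhoffMax θ g (n + 1) x := by
  induction n generalizing x with
  | zero => exact le_max_left _ _
  | succ n ih => exact max_le_max le_rfl (by simpa using ih (θ x))

lemma birkhoffSum_le_birkhoffMax (n : ℕ) (x : α) :
    birkhoffSum θ g n x ≤ birkhoffMax θ g n x := by
  induction n generalizing x with
  | zero => simp [birkhoffMax]
  | succ n ih =>
    rw [birkhoffSum_succ']
    exact (add_le_add le_rfl (ih (θ x))).trans (le_max_right _ _)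

/-- The pointwise inequality behind the maximal ergodic theorem. The left-hand side is a
coboundary. -/
lemma birkhoffMax_sub_comp_le (n : ℕ) (x : α) :
    birkhoffMax θ g n x - birkhoffMax θ g n (θ x) ≤
      {y | 0 < birkhoffMax θ g n y}.indicator g x := by
  by_cases hx : 0 < birkhoffMax θ g n x
  · rw [indicator_of_mem (by exact hx)]
    have h := birkhoffMax_le_succ (θ := θ) (g := g) n x
    rw [birkhoffMax] at h
    rcases le_max_iff.1 h with h | h <;> linarith
  · rw [indicator_of_notMem (by exact hx)]
    have := birkhoffMax_nonneg (θ := θ) (g := g) n (θ x)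
    linarith

variable [MeasurableSpace α] {μ : Measure α}

lemma integrable_birkhoffMax (hθ : MeasurePreserving θ μ μ) (hg : Integrable g μ) (n : ℕ) :
    Integrable (birkhoffMax θ g n) μ := by
  induction n with
  | zero => exact integrable_zero _ _ _
  | succ n ih =>
    exact (integrable_zero _ _ _).sup (hg.add (hθ.integrable_comp_of_integrable ih))

lemma measurable_birkhoffMax (hθ : Measurable θ) (hg : Measurable g) (n : ℕ) :
    Measurable (birkhoffMax θ g n) := by
  induction n with
  | zero => exact measurable_const
  | succ n ih => exact measurable_const.max (hg.add (ih.comp hθ))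

/-- The maximal ergodic theorem, in the case where almost every orbit has a positive Birkhoff
sum. -/
theorem integral_nonneg_of_ae_exists_birkhoffSum_pos (hθ : MeasurePreserving θ μ μ)
    (hg : Integrable g μ) (hgm : Measurable g)
    (h : ∀ᵐ x ∂μ, ∃ n, 0 < birkhoffSum θ g n x) : 0 ≤ ∫ x, g x ∂μ := by
  have hmeas : ∀ n, MeasurableSet {y | 0 < birkhoffMax θ g n y} := fun n =>
    measurableSet_lt measurable_const (measurable_birkhoffMax hθ.measurable hgm n)
  have hlim : Tendsto (fun n => ∫ x, {y | 0 < birkhoffMax θ g n y}.indicator g x ∂μ) atTop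
      (nhds (∫ x, g x ∂μ)) := by
    refine tendsto_integral_of_dominated_convergence (fun x => ‖g x‖)
      (fun n => (hg.indicator (hmeas n)).aestronglyMeasurable) hg.norm
      (fun n => ae_of_all _ fun x => norm_indicator_le_norm_self _ _) ?_
    filter_upwards [h] with x ⟨n, hn⟩
    refine tendsto_const_nhds.congr' ?_
    filter_upwards [eventually_ge_atTop n] with m hm
    rw [indicator_of_mem]
    exact (hn.trans_le (birkhoffSum_le_birkhoffMax n x)).trans_le
      (monotone_nat_of_le_succ (fun n => birkhoffMax_le_succ (θ := θ) (g := g) n x) hm)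
  refine ge_of_tendsto' hlim fun n => ?_
  have hM := integrable_birkhoffMax hθ hg n
  have hM' : Integrable (fun x => birkhoffMax θ g n (θ x)) μ :=
    hθ.integrable_comp_of_integrable hM
  have h0 : ∫ x, birkhoffMax θ g n (θ x) ∂μ = ∫ x, birkhoffMax θ g n x ∂μ := by
    have := integral_map (μ := μ) hθ.aemeasurable
      (f := birkhoffMax θ g n) (by rw [hθ.map_eq]; exact hM.aestronglyMeasurable)
    rw [← this, hθ.map_eq]
  calc (0 : ℝ) = ∫ x, (birkhoffMax θ g n x - birkhoffMax θ g n (θ x)) ∂μ := by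
        rw [integral_sub hM hM', h0, sub_self]
    _ ≤ _ := integral_mono (hM.sub hM') (hg.indicator (hmeas n))
        fun x => birkhoffMax_sub_comp_le n x

/-- A function with positive integral has Birkhoff sums that are bounded below along almost every
orbit: being unbounded below is an invariant property, and the maximal ergodic theorem excludes
that it holds almost everywhere. -/
theorem Ergodic.ae_exists_le_birkhoffSum [IsProbabilityMeasure μ] (hθ : Ergodic θ μ)
    {f : α → ℝ} (hf : Integrable f μ) (hfm : Measurable f) (hpos : 0 < ∫ x, f x ∂μ) :
    ∀ᵐ x ∂μ, ∃ K : ℕ, ∀ n, -(K : ℝ) ≤ birkhoffSum θ f n x := by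
  have hS : ∀ n, Measurable (birkhoffSum θ f n) := fun n => by
    unfold birkhoffSum
    exact Finset.measurable_fun_sum _ fun i _ =>
      hfm.comp (hθ.measurable.iterate i)
  set B : Set α := {x | ∃ K : ℕ, ∀ n, -(K : ℝ) ≤ birkhoffSum θ f n x} with hB
  have hBm : MeasurableSet B := by
    simp only [hB, ofPred_exists, ofPred_forall]
    exact .iUnion fun K => .iInter fun n => measurableSet_le measurable_const (hS n)
  have hinv : θ ⁻¹' B = B := by
    ext x
    simp only [hB, mem_preimage, mem_ofPred_eq]
    obtain ⟨L, hL⟩ := exists_nat_ge |f x|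
    have hL' := abs_le.1 hL
    constructor
    · rintro ⟨K, hK⟩
      refine ⟨K + L, fun n => ?_⟩
      push_cast
      cases n with
      | zero =>
        simp only [birkhoffSum_zero]
        linarith [K.cast_nonneg (α := ℝ), L.cast_nonneg (α := ℝ)]
      | succ n => rw [birkhoffSum_succ']; linarith [hK n]
    · rintro ⟨K, hK⟩
      refine ⟨K + L, fun n => ?_⟩
      have := hK (n + 1)
      rw [birkhoffSum_succ'] at this
      push_cast
      linarith
  rcases hθ.toPreErgodic.ae_mem_or_ae_notMem hBm hinv with h | h
  · exact h
  · exfalso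
    have key : 0 ≤ ∫ x, (-f) x ∂μ := by
      refine integral_nonneg_of_ae_exists_birkhoffSum_pos hθ.toMeasurePreserving hf.neg hfm.neg ?_
      filter_upwards [h] with x hx
      have hx' : ¬ ∃ K : ℕ, ∀ n, -(K : ℝ) ≤ birkhoffSum θ f n x := hx
      push Not at hx'
      obtain ⟨n, hn⟩ := hx' 0
      refine ⟨n, ?_⟩
      have : birkhoffSum θ (-f) n x = - birkhoffSum θ f n x := by
        simp [birkhoffSum]
      rw [this]
      simpa using hn
    simp only [Pi.neg_apply, integral_neg] at key
    linarith

/-- The lower half of the pointwise ergodic theorem for the times `1, …, n` at which an orbit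
visits a measurable set. -/
theorem Ergodic.ae_exists_le_ncard_visits [IsProbabilityMeasure μ] (hθ : Ergodic θ μ)
    {A : Set α} (hA : MeasurableSet A) {c : ℝ} (hc : c < μ.real A) :
    ∀ᵐ x ∂μ, ∃ K : ℕ, ∀ n : ℕ,
      c * n - K ≤ (({t | θ^[t] x ∈ A} ∩ Icc 1 n).ncard : ℝ) := by
  have hind : Integrable (A.indicator fun _ => (1 : ℝ)) μ :=
    (integrable_const (1 : ℝ)).indicator hA
  have h := hθ.ae_exists_le_birkhoffSum (f := fun x => A.indicator (fun _ => (1 : ℝ)) x - c)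
    (hind.sub (integrable_const c)) ((measurable_const.indicator hA).sub measurable_const)
    (by
      rw [integral_sub hind (integrable_const c), integral_indicator_const _ hA]
      simpa using hc)
  -- the times `1, …, n` of `x` are the times `0, …, n - 1` of `θ x`
  filter_upwards [hθ.quasiMeasurePreserving.ae h] with x ⟨K, hK⟩
  refine ⟨K, fun n => ?_⟩
  have hcount : birkhoffSum θ (fun x => A.indicator (fun _ => (1 : ℝ)) x - c) n (θ x) =
      (({t | θ^[t] x ∈ A} ∩ Icc 1 n).ncard : ℝ) - c * n := by
    classical
    have hset : {t | θ^[t] x ∈ A} ∩ Icc 1 n =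
        (((Finset.range n).filter fun t => θ^[t] (θ x) ∈ A).image Nat.succ : Finset ℕ) := by
      ext t
      simp only [mem_inter_iff, mem_ofPred_eq, mem_Icc, SetLike.mem_coe, Finset.mem_image]
      constructor
      · rintro ⟨h1, h2, h3⟩
        refine ⟨t - 1, Finset.mem_filter.2 ⟨Finset.mem_range.2 (by omega), ?_⟩, by omega⟩
        rwa [← Function.iterate_succ_apply, Nat.succ_eq_add_one, Nat.sub_add_cancel h2]
      · rintro ⟨s, hs, rfl⟩
        obtain ⟨h1, h2⟩ := Finset.mem_filter.1 hs
        rw [Finset.mem_range] at h1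
        exact ⟨h2, by omega, by omega⟩
    rw [hset, ncard_coe_finset, Finset.card_image_of_injective _ Nat.succ_injective]
    simp only [birkhoffSum, Finset.sum_sub_distrib, Finset.sum_const, Finset.card_range,
      nsmul_eq_mul, Finset.card_filter, indicator_apply]
    push_cast
    ring
  have := hK n
  rw [hcount] at this
  linarith

end Birkhoff

/-! ### Lower densities of sets of times -/

namespace MRN

lemma ncard_inter_Icc_le (A : Set ℕ) (n : ℕ) : (A ∩ Icc 1 n).ncard ≤ n := by
  calc (A ∩ Icc 1 n).ncard ≤ (Icc 1 n).ncard :=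
        ncard_le_ncard inter_subset_right (finite_Icc 1 n)
    _ = n := by simp [← Finset.coe_Icc, ncard_coe_finset]

/-- A linear lower bound for the counting function, up to a constant, bounds the lower density. -/
lemma lt_lowerDensity {A : Set ℕ} {c c' K : ℝ} (hc : c < c')
    (h : ∀ n : ℕ, c' * n - K ≤ ((A ∩ Icc 1 n).ncard : ℝ)) : c < lowerDensity A := by
  have hb : ∀ᶠ n : ℕ in atTop, (c + c') / 2 ≤ ((A ∩ Icc 1 n).ncard : ℝ) / n := by
    filter_upwards [tendsto_natCast_atTop_atTop.eventually_ge_atTop (K / ((c' - c) / 2)),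
      eventually_gt_atTop 0] with n hn hn0
    have hn0' : (0 : ℝ) < n := by exact_mod_cast hn0
    rw [div_le_iff₀ (by linarith)] at hn
    rw [le_div_iff₀ hn0']
    linarith [h n]
  refine lt_of_lt_of_le (by linarith : c < (c + c') / 2) ?_
  refine le_liminf_of_le ?_ hb
  refine IsBoundedUnder.isCoboundedUnder_ge ⟨1, ?_⟩
  simp only [eventually_map]
  refine Eventually.of_forall fun n => ?_
  exact div_le_one_of_le₀ (by exact_mod_cast ncard_inter_Icc_le A n) (by positivity)

/-- The times `t` at which `⌊t a⌋` jumps: a set of density `a`, if `0 ≤ a ≤ 1`. -/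
def beattySet (a : ℝ) : Set ℕ := {t | ⌊(t : ℝ) * a⌋₊ < ⌊((t + 1 : ℕ) : ℝ) * a⌋₊}

lemma floor_succ_mul_le {a : ℝ} (h0 : 0 ≤ a) (h1 : a ≤ 1) (n : ℕ) :
    ⌊((n + 1 : ℕ) : ℝ) * a⌋₊ ≤ ⌊(n : ℝ) * a⌋₊ + 1 := by
  rw [← Nat.floor_add_one (by positivity)]
  apply Nat.floor_le_floor
  push_cast
  linarith

lemma ncard_beattySet {a : ℝ} (h0 : 0 ≤ a) (h1 : a < 1) (n : ℕ) :
    (beattySet a ∩ Icc 1 n).ncard = ⌊((n + 1 : ℕ) : ℝ) * a⌋₊ := by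
  induction n with
  | zero => simp [Nat.floor_eq_zero.2 h1]
  | succ n ih =>
    have hI : Icc 1 (n + 1) = insert (n + 1) (Icc 1 n) := by
      ext t; simp only [mem_Icc, mem_insert_iff]; omega
    have hfin : (beattySet a ∩ Icc 1 n).Finite := (finite_Icc 1 n).inter_of_right _
    have hle := floor_succ_mul_le h0 h1.le (n + 1)
    have hmono : ⌊((n + 1 : ℕ) : ℝ) * a⌋₊ ≤ ⌊((n + 1 + 1 : ℕ) : ℝ) * a⌋₊ := by
      apply Nat.floor_le_floor
      push_cast
      nlinarith
    rw [hI]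
    by_cases hm : n + 1 ∈ beattySet a
    · rw [inter_insert_of_mem hm, ncard_insert_of_notMem (by simp) hfin, ih]
      have hm' : ⌊((n + 1 : ℕ) : ℝ) * a⌋₊ < ⌊((n + 1 + 1 : ℕ) : ℝ) * a⌋₊ := hm
      omega
    · rw [inter_insert_of_notMem hm, ih]
      have hm' : ¬ ⌊((n + 1 : ℕ) : ℝ) * a⌋₊ < ⌊((n + 1 + 1 : ℕ) : ℝ) * a⌋₊ := hm
      omega

lemma le_ncard_beattySet {a : ℝ} (h0 : 0 ≤ a) (h1 : a < 1) (n : ℕ) :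
    a * n - 1 ≤ ((beattySet a ∩ Icc 1 n).ncard : ℝ) := by
  rw [ncard_beattySet h0 h1]
  have := Nat.lt_floor_add_one (((n + 1 : ℕ) : ℝ) * a)
  push_cast at this ⊢
  linarith

lemma ncard_add_ncard_compl (A : Set ℕ) (n : ℕ) :
    (A ∩ Icc 1 n).ncard + (Aᶜ ∩ Icc 1 n).ncard = n := by
  rw [← ncard_union_eq (disjoint_compl_right.mono inter_subset_left inter_subset_left)
    ((finite_Icc 1 n).inter_of_right _) ((finite_Icc 1 n).inter_of_right _),
    ← union_inter_distrib_right, union_compl_self, univ_inter]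
  simp [← Finset.coe_Icc, ncard_coe_finset]

lemma le_ncard_compl_beattySet {a : ℝ} (h0 : 0 ≤ a) (h1 : a < 1) (n : ℕ) :
    (1 - a) * n - 1 ≤ (((beattySet a)ᶜ ∩ Icc 1 n).ncard : ℝ) := by
  have h := ncard_add_ncard_compl (beattySet a) n
  rw [ncard_beattySet h0 h1] at h
  have h2 := Nat.floor_le (a := ((n + 1 : ℕ) : ℝ) * a) (by positivity)
  have h' : (⌊((n + 1 : ℕ) : ℝ) * a⌋₊ : ℝ) + (((beattySet a)ᶜ ∩ Icc 1 n).ncard : ℝ) = n := by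
    exact_mod_cast h
  push_cast at h' h2
  linarith

/-- Two sets of times lose at most the sum of their defects when they are intersected. -/
lemma add_ncard_sub_le_ncard_inter (A B : Set ℕ) (n : ℕ) :
    ((A ∩ Icc 1 n).ncard : ℝ) + (B ∩ Icc 1 n).ncard - n ≤ ((A ∩ B ∩ Icc 1 n).ncard : ℝ) := by
  have h1 : (A ∩ Icc 1 n).ncard ≤ (A ∩ B ∩ Icc 1 n).ncard + (Bᶜ ∩ Icc 1 n).ncard := by
    refine (ncard_le_ncard (t := (A ∩ B ∩ Icc 1 n) ∪ (Bᶜ ∩ Icc 1 n)) ?_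
      (((finite_Icc 1 n).inter_of_right _).union ((finite_Icc 1 n).inter_of_right _))).trans
      (ncard_union_le _ _)
    rintro t ⟨hA, ht⟩
    by_cases hB : t ∈ B
    · exact .inl ⟨⟨hA, hB⟩, ht⟩
    · exact .inr ⟨hB, ht⟩
  have h2 := ncard_add_ncard_compl B n
  have h1' : ((A ∩ Icc 1 n).ncard : ℝ) ≤ (A ∩ B ∩ Icc 1 n).ncard + (Bᶜ ∩ Icc 1 n).ncard := by
    exact_mod_cast h1
  have h2' : ((B ∩ Icc 1 n).ncard : ℝ) + (Bᶜ ∩ Icc 1 n).ncard = n := by exact_mod_cast h2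
  linarith

lemma sub_le_ncard_Ici (m n : ℕ) : (n : ℝ) - m ≤ ((Ici m ∩ Icc 1 n).ncard : ℝ) := by
  have h := ncard_add_ncard_compl (Ici m) n
  have h2 : ((Ici m)ᶜ ∩ Icc 1 n).ncard ≤ m := by
    refine (ncard_le_ncard (t := ((Finset.range m : Finset ℕ) : Set ℕ)) ?_
      (Finset.finite_toSet _)).trans (by rw [ncard_coe_finset, Finset.card_range])
    rintro t ⟨ht, -⟩
    simpa using ht
  have h' : ((Ici m ∩ Icc 1 n).ncard : ℝ) + ((Ici m)ᶜ ∩ Icc 1 n).ncard = n := by exact_mod_cast h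
  have h2' : (((Ici m)ᶜ ∩ Icc 1 n).ncard : ℝ) ≤ m := by exact_mod_cast h2
  linarith

end MRN

/-! ### Regular orbits and derivatives of the cocycle -/

namespace MRN

variable {Ω : Type u} [MeasurableSpace Ω] {k : ℕ} {θ : Ω ≃ᵐ Ω} {μ : Measure Ω}

/-- The properties that hold at almost every point `ω`, for a smooth perturbation `X` of a
deterministic network `X₀` with synchronization index `J` and pull-back synchronization time
`N`. -/
structure IsRegularAt (X : ℝ → MRN k θ μ) (X₀ : MRN k θ μ) (J : Ω → Fin k) (N : Ω → ℕ) (ε₀ : ℝ)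
    (ω : Ω) : Prop where
  markov₀ : IsMarkovAt θ X₀.law ω
  det : ∀ (n : ℕ) (i j : Fin k), X₀.trans n ω i j = 0 ∨ X₀.trans n ω i j = 1
  markov : ∀ ε : ℝ, 0 ≤ ε → IsMarkovAt θ (X ε).law ω
  close : ∀ ε : ℝ, 0 ≤ ε → ∀ i j, |(X ε).trans 1 ω i j - X₀.trans 1 ω i j| ≤ ε
  smooth : ∀ i j : Fin k, ContDiffOn ℝ 1 (fun ε => (X ε).trans 1 ω i j) (Icc 0 ε₀)
  index : ∀ (n : ℕ) (i : Fin k), X₀.trans n ω i (J ω) = if i = J (θ^[n] ω) then 1 else 0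
  pullback : ∀ (j : Fin k), ∀ n ≥ N ω, ∀ i,
    X₀.trans n (θ.symm^[n] ω) i j = if i = J ω then 1 else 0

/-- Regularity along the whole two-sided orbit of `ω`. -/
def IsRegularOrbit (X : ℝ → MRN k θ μ) (X₀ : MRN k θ μ) (J : Ω → Fin k) (N : Ω → ℕ) (ε₀ : ℝ)
    (ω : Ω) : Prop :=
  ∀ m t : ℕ, IsRegularAt X X₀ J N ε₀ (θ^[t] (θ.symm^[m] ω))

lemma iterate_symm_iterate (m : ℕ) (ω : Ω) : θ^[m] (θ.symm^[m] ω) = ω :=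
  Function.LeftInverse.iterate (show Function.LeftInverse θ θ.symm from θ.apply_symm_apply) m ω

lemma symm_iterate_iterate (m : ℕ) (ω : Ω) : θ.symm^[m] (θ^[m] ω) = ω :=
  Function.LeftInverse.iterate (show Function.LeftInverse θ.symm θ from θ.symm_apply_apply) m ω

lemma symm_iterate_iterate_of_le {m n : ℕ} (h : m ≤ n) (ω : Ω) :
    θ.symm^[m] (θ^[n] ω) = θ^[n - m] ω := by
  conv_lhs => rw [← Nat.add_sub_cancel' h, Function.iterate_add_apply, symm_iterate_iterate]

lemma ae_forall_orbit (hθ : MeasurePreserving θ μ μ) {P : Ω → Prop} (h : ∀ᵐ ω ∂μ, P ω) :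
    ∀ᵐ ω ∂μ, ∀ m t : ℕ, P (θ^[t] (θ.symm^[m] ω)) := by
  rw [ae_all_iff]; intro m
  rw [ae_all_iff]; intro t
  have hs : MeasurePreserving θ.symm μ μ := hθ.symm θ
  exact ((hθ.iterate t).quasiMeasurePreserving.comp
    (hs.iterate m).quasiMeasurePreserving).ae h

section Regular

variable {X : ℝ → MRN k θ μ} {X₀ : MRN k θ μ} {J : Ω → Fin k} {N : Ω → ℕ} {ε₀ : ℝ} {ω : Ω}

lemma ae_isRegularOrbit (hθ : MeasurePreserving θ μ μ) {m : ℕ} (hm : 1 ≤ m)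
    (hsmooth : ∀ᵐ ω ∂μ, ∀ i j : Fin k,
      ContDiffOn ℝ m (fun ε => (X ε).trans 1 ω i j) (Icc 0 ε₀))
    (hdet : X₀.IsDeterministic) (hX : IsMarkovPerturbation X X₀)
    (hJ : X₀.IsSyncIndex J) (hN : X₀.IsPullbackSyncTime J N) :
    ∀ᵐ ω ∂μ, IsRegularOrbit X X₀ J N ε₀ ω := by
  refine ae_forall_orbit hθ ?_
  filter_upwards [hsmooth, hdet, hX, hJ.2, hN.2, X₀.ae_isMarkovAt] with ω h1 h2 h3 h4 h5 h6
  refine ⟨h6, h2, fun ε hε => (h3 ε hε).1,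
    fun ε hε i j => (abs_apply_le_oneNorm ((X ε).trans 1 ω - X₀.trans 1 ω) i j).trans (h3 ε hε).2,
    fun i j => (h1 i j).of_le (by exact_mod_cast hm), fun n i => ?_, fun j n hn i => ?_⟩
  · have := congrFun (h4 n) i
    rwa [Matrix.mulVec_single_one, Matrix.col_apply, Pi.single_apply] at this
  · have := congrFun (h5 j n hn) i
    rwa [Matrix.mulVec_single_one, Matrix.col_apply, Pi.single_apply] at this

namespace IsRegularOrbit

lemma symm_iterate (h : IsRegularOrbit X X₀ J N ε₀ ω) (n : ℕ) :
    IsRegularOrbit X X₀ J N ε₀ (θ.symm^[n] ω) := fun m t => by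
  rw [← Function.iterate_add_apply]; exact h _ _

lemma map (h : IsRegularOrbit X X₀ J N ε₀ ω) : IsRegularOrbit X X₀ J N ε₀ (θ ω) := fun m t => by
  cases m with
  | zero => exact h 0 (t + 1)
  | succ m =>
    rw [Function.iterate_succ_apply, θ.symm_apply_apply]
    exact h m t

lemma iterate (h : IsRegularOrbit X X₀ J N ε₀ ω) (n : ℕ) :
    IsRegularOrbit X X₀ J N ε₀ (θ^[n] ω) := by
  induction n with
  | zero => exact h
  | succ n ih => rw [Function.iterate_succ_apply']; exact ih.map

lemma markovAlong₀ (h : IsRegularOrbit X X₀ J N ε₀ ω) : X₀.MarkovAlong ω :=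
  fun t => (h 0 t).markov₀

lemma markovAlong (h : IsRegularOrbit X X₀ J N ε₀ ω) {ε : ℝ} (hε : 0 ≤ ε) :
    (X ε).MarkovAlong ω :=
  fun t => (h 0 t).markov ε hε

lemma regular (h : IsRegularOrbit X X₀ J N ε₀ ω) : IsRegularAt X X₀ J N ε₀ ω := h 0 0

lemma index_iterate (h : IsRegularOrbit X X₀ J N ε₀ ω) (n : ℕ) (i : Fin k) :
    X₀.trans n (θ.symm^[n] ω) i (J (θ.symm^[n] ω)) = if i = J ω then 1 else 0 := by
  have := (h n 0).index n i
  rwa [Function.iterate_zero_apply, iterate_symm_iterate] at this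

variable [MeasurableSingletonClass Ω]

/-- The bound on the perturbation at `ε = 0` forces the same transition matrices, although
`X 0` and `X₀` themselves need not agree. -/
lemma trans_zero_eq (h : IsRegularOrbit X X₀ J N ε₀ ω) (n : ℕ) :
    (X 0).trans n ω = X₀.trans n ω := by
  induction n with
  | zero => rw [(h.markovAlong le_rfl).trans_zero, h.markovAlong₀.trans_zero]
  | succ n ih =>
    rw [(h.markovAlong le_rfl).trans_succ, h.markovAlong₀.trans_succ, ih]
    congr 1
    ext i j
    exact sub_eq_zero.1 (abs_nonpos_iff.1 ((h 0 n).close 0 le_rfl i j))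

/-- From whatever state it starts at time `-n`, where `n ≥ N(ω)`, the deterministic network is in
the state `J(ω)` at time `0`, and the perturbed network is there with probability at least
`1 - n ε`. -/
lemma one_sub_le_trans_index (h : IsRegularOrbit X X₀ J N ε₀ ω) {n : ℕ} (hn : N ω ≤ n) {ε : ℝ}
    (hε : 0 ≤ ε) (j : Fin k) : 1 - n * ε ≤ (X ε).trans n (θ.symm^[n] ω) (J ω) j := by
  have h' := h.symm_iterate n
  refine one_sub_le_trans (h'.markovAlong hε) h'.markovAlong₀ (h n 0).det
    (fun t => (h n t).close ε hε) n ?_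
  exact (h.regular.pullback j n hn _).trans (if_pos rfl)

lemma hasDerivWithinAt_trans (h : IsRegularOrbit X X₀ J N ε₀ ω) (hε₀ : 0 < ε₀) (n : ℕ)
    (i j : Fin k) :
    HasDerivWithinAt (fun ε => (X ε).trans n ω i j) (transDeriv X n ω i j) (Ici 0) 0 := by
  refine DifferentiableWithinAt.hasDerivWithinAt ?_
  induction n generalizing i with
  | zero =>
    refine (differentiableWithinAt_const ((1 : Matrix (Fin k) (Fin k) ℝ) i j)).congr
      (fun ε hε => ?_) ?_
    · rw [(h.markovAlong hε).trans_zero]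
    · rw [(h.markovAlong le_rfl).trans_zero]
  | succ n ih =>
    have h1 : ∀ l, DifferentiableWithinAt ℝ (fun ε => (X ε).trans 1 (θ^[n] ω) i l) (Ici 0) 0 :=
      fun l => (((h 0 n).smooth i l).differentiableOn one_ne_zero 0
        (left_mem_Icc.2 hε₀.le)).mono_of_mem_nhdsWithin (Icc_mem_nhdsGE hε₀)
    have heq : ∀ ε : ℝ, 0 ≤ ε → (X ε).trans (n + 1) ω i j =
        ∑ l, (X ε).trans 1 (θ^[n] ω) i l * (X ε).trans n ω l j := fun ε hε => by
      rw [(h.markovAlong hε).trans_succ, Matrix.mul_apply]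
    refine (DifferentiableWithinAt.fun_sum fun l _ => (h1 l).mul (ih l)).congr heq (heq 0 le_rfl)

lemma continuousOn_trans (h : IsRegularOrbit X X₀ J N ε₀ ω) (n : ℕ) (i j : Fin k) :
    ContinuousOn (fun ε => (X ε).trans n ω i j) (Icc 0 ε₀) := by
  induction n generalizing i with
  | zero =>
    refine (continuousOn_const (c := (1 : Matrix (Fin k) (Fin k) ℝ) i j)).congr fun ε hε => ?_
    rw [(h.markovAlong hε.1).trans_zero]
  | succ n ih =>
    have hc : ContinuousOn (fun ε => ∑ l, (X ε).trans 1 (θ^[n] ω) i l * (X ε).trans n ω l j)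
        (Icc 0 ε₀) :=
      continuousOn_finsetSum _ fun l _ => ((h 0 n).smooth i l).continuousOn.mul (ih l)
    refine hc.congr fun ε hε => ?_
    simp only [(h.markovAlong hε.1).trans_succ, Matrix.mul_apply]

/-- The product rule for the cocycle. -/
lemma transDeriv_add (h : IsRegularOrbit X X₀ J N ε₀ ω) (hε₀ : 0 < ε₀) (m n : ℕ) :
    transDeriv X (m + n) ω =
      transDeriv X m (θ^[n] ω) * X₀.trans n ω + X₀.trans m (θ^[n] ω) * transDeriv X n ω := by
  ext i j
  have heq : ∀ ε : ℝ, 0 ≤ ε → (X ε).trans (m + n) ω i j =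
      ∑ l, (X ε).trans m (θ^[n] ω) i l * (X ε).trans n ω l j := fun ε hε => by
    rw [(h.markovAlong hε).trans_add, Matrix.mul_apply]
  have h1 := (HasDerivWithinAt.fun_sum fun l (_ : l ∈ Finset.univ) =>
    ((h.iterate n).hasDerivWithinAt_trans hε₀ m i l).mul
      (h.hasDerivWithinAt_trans hε₀ n l j)).congr heq (heq 0 le_rfl)
  rw [(uniqueDiffWithinAt_Ici 0).eq_deriv _ (h.hasDerivWithinAt_trans hε₀ (m + n) i j) h1]
  simp only [h.trans_zero_eq, (h.iterate n).trans_zero_eq, Finset.sum_add_distrib,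
    Matrix.add_apply, Matrix.mul_apply]

lemma sum_transDeriv (h : IsRegularOrbit X X₀ J N ε₀ ω) (hε₀ : 0 < ε₀) (n : ℕ) (j : Fin k) :
    ∑ i, transDeriv X n ω i j = 0 := by
  have h1 := HasDerivWithinAt.fun_sum fun i (_ : i ∈ Finset.univ) =>
    h.hasDerivWithinAt_trans hε₀ n i j
  have h2 : HasDerivWithinAt (fun ε => ∑ i, (X ε).trans n ω i j) 0 (Ici 0) 0 :=
    (hasDerivWithinAt_const 0 _ (1 : ℝ)).congr
      (fun ε hε => (h.markovAlong hε).sum_trans n j) ((h.markovAlong le_rfl).sum_trans n j)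
  exact (uniqueDiffWithinAt_Ici 0).eq_deriv _ h1 h2

/-- The first-order coefficient does not depend on the choice of the pull-back time. -/
lemma firstCoeff_eq_of_le (h : IsRegularOrbit X X₀ J N ε₀ ω) (hε₀ : 0 < ε₀) {n : ℕ}
    (hn : N ω ≤ n) (i : Fin k) :
    transDeriv X n (θ.symm^[n] ω) i (J (θ.symm^[n] ω)) = firstCoeff X J N ω i := by
  have h' := h.symm_iterate n
  have hω : θ^[n - N ω] (θ.symm^[n] ω) = θ.symm^[N ω] ω := by
    conv_lhs => rw [← Nat.sub_add_cancel hn, Function.iterate_add_apply, Nat.add_sub_cancel,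
      iterate_symm_iterate]
  have hadd := h'.transDeriv_add hε₀ (N ω) (n - N ω)
  rw [Nat.add_sub_cancel' hn, hω] at hadd
  rw [hadd, firstCoeff, Matrix.mulVec_single_one, Matrix.col_apply, Matrix.add_apply,
    Matrix.mul_apply, Matrix.mul_apply]
  have h1 : ∀ l, X₀.trans (n - N ω) (θ.symm^[n] ω) l (J (θ.symm^[n] ω)) =
      if l = J (θ.symm^[N ω] ω) then 1 else 0 := fun l => by
    have := (h n 0).index (n - N ω) l
    rwa [Function.iterate_zero_apply, hω] at this
  have h2 : ∀ l, X₀.trans (N ω) (θ.symm^[N ω] ω) i l = if i = J ω then 1 else 0 :=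
    fun l => h.regular.pullback l (N ω) le_rfl i
  simp only [h1, h2, ← Finset.mul_sum, h'.sum_transDeriv hε₀]
  simp

/-- The invariance equation of the first-order coefficient shows that it vanishes at `ω` and at
`θ ω` only if the dissipation at `ω` vanishes. -/
lemma dissipation_eq_zero (h : IsRegularOrbit X X₀ J N ε₀ ω) (hε₀ : 0 < ε₀)
    (h0 : firstCoeff X J N ω = 0) (h1 : firstCoeff X J N (θ ω) = 0) :
    dissipation X J ω = 0 := by
  -- a common pull-back time for `ω` and for `θ ω`, at which it is increased by one
  set n := max (N ω) (N (θ ω)) with hn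
  have h' := h.symm_iterate n
  have hω : θ.symm^[n + 1] (θ ω) = θ.symm^[n] ω := by
    rw [Function.iterate_succ_apply, θ.symm_apply_apply]
  have hadd := h'.transDeriv_add hε₀ 1 n
  rw [iterate_symm_iterate, Nat.add_comm] at hadd
  ext i
  have h2 := h.map.firstCoeff_eq_of_le hε₀ (n := n + 1) (by omega) i
  rw [h1, hω, hadd, Matrix.add_apply, Matrix.mul_apply, Matrix.mul_apply] at h2
  have h3 := fun l => h.firstCoeff_eq_of_le hε₀ (n := n) (by omega) l
  simp only [h3, h0, h.index_iterate] at h2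
  rw [dissipation, Matrix.mulVec_single_one, Matrix.col_apply]
  simpa using h2

end IsRegularOrbit

end Regular

end MRN

/-! ### Two facts from analysis -/

/-- A nonnegative function that vanishes at `0` with a nonzero one-sided derivative there grows at
least linearly. -/
lemma HasDerivWithinAt.exists_pos_mul_le {f : ℝ → ℝ} {c : ℝ}
    (hf : HasDerivWithinAt f c (Ici 0) 0) (h0 : f 0 = 0) (hnn : ∀ x, 0 ≤ x → 0 ≤ f x)
    (hc : c ≠ 0) : ∃ r : ℝ, 0 < r ∧ ∀ x, 0 ≤ x → x ≤ r → r * x ≤ f x := by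
  have ht : Tendsto (slope f 0) (nhdsWithin 0 (Ioi 0)) (nhds c) :=
    (hasDerivWithinAt_iff_tendsto_slope' self_notMem_Ioi).1 (hasDerivWithinAt_Ioi_iff_Ici.2 hf)
  have hslope : ∀ x, slope f 0 x = f x / x := fun x => by
    rw [slope_def_field, h0, sub_zero, sub_zero]
  have hc0 : 0 < c := lt_of_le_of_ne (ge_of_tendsto ht (by
    filter_upwards [self_mem_nhdsWithin] with x hx
    rw [hslope]
    exact div_nonneg (hnn x (le_of_lt hx)) (le_of_lt hx))) hc.symm
  obtain ⟨b, hb, hsub⟩ := mem_nhdsGT_iff_exists_Ioc_subset.1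
    (ht.eventually (lt_mem_nhds (half_lt_self hc0)))
  refine ⟨min b (c / 2), lt_min hb (half_pos hc0), fun x hx hxr => ?_⟩
  rcases hx.eq_or_lt with rfl | hx
  · simp [h0]
  · have h1 : c / 2 < slope f 0 x := hsub ⟨hx, hxr.trans (min_le_left _ _)⟩
    rw [hslope, lt_div_iff₀ hx] at h1
    exact (mul_le_mul_of_nonneg_right (min_le_right _ _) hx.le).trans h1.le

lemma exists_forall_ge_lt_measureReal {α : Type*} [MeasurableSpace α] {μ : Measure α}
    [IsFiniteMeasure μ] {s : ℕ → Set α} (hs : Monotone s) {c : ℝ} (hc : c < μ.real (⋃ n, s n)) :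
    ∃ M, ∀ n ≥ M, c < μ.real (s n) := by
  have h := (ENNReal.tendsto_toReal (measure_ne_top μ (⋃ n, s n))).comp
    (tendsto_measure_iUnion_atTop (μ := μ) hs)
  exact eventually_atTop.1 (h.eventually (lt_mem_nhds hc))

/-! ### The escape probability and the first-order coefficient -/

namespace MRN

variable {Ω : Type u} [MeasurableSpace Ω] {k : ℕ} {θ : Ω ≃ᵐ Ω} {μ : Measure Ω}

lemma le_mulVec_of_forall_le {A : Matrix (Fin k) (Fin k) ℝ} {v : Fin k → ℝ} {i : Fin k} {c : ℝ}
    (hv : v ∈ stdSimplex ℝ (Fin k)) (h : ∀ l, c ≤ A i l) : c ≤ (A *ᵥ v) i := by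
  calc c = ∑ l, c * v l := by rw [← Finset.mul_sum, hv.2, mul_one]
    _ ≤ ∑ l, A i l * v l :=
      Finset.sum_le_sum fun l _ => mul_le_mul_of_nonneg_right (h l) (hv.1 l)
    _ = (A *ᵥ v) i := by simp only [Matrix.mulVec, dotProduct]

/-- The mass that a matrix moves from the coordinate `j` to coordinates other than `i` is missing
at `i`. -/
lemma mulVec_le_one_sub {A : Matrix (Fin k) (Fin k) ℝ} {v : Fin k → ℝ} {i : Fin k}
    (hv : v ∈ stdSimplex ℝ (Fin k)) (h : ∀ l, A i l ≤ 1) (j : Fin k) :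
    (A *ᵥ v) i ≤ 1 - v j * (1 - A i j) := by
  have h1 : v j * (1 - A i j) ≤ ∑ l, v l * (1 - A i l) :=
    Finset.single_le_sum (f := fun l => v l * (1 - A i l))
      (fun l _ => mul_nonneg (hv.1 l) (sub_nonneg.2 (h l))) (Finset.mem_univ j)
  have h2 : ∑ l, v l * (1 - A i l) = 1 - (A *ᵥ v) i := by
    simp only [Matrix.mulVec, dotProduct, mul_sub, mul_one, Finset.sum_sub_distrib, hv.2]
    simp only [mul_comm]
  linarith

/-- The probability that the network, started at time `-N(ω)` in its synchronized state, has left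
the synchronized state at time `0`. -/
noncomputable def escapeProb (Y : MRN k θ μ) (J : Ω → Fin k) (N : Ω → ℕ) (ω : Ω) : ℝ :=
  1 - Y.trans (N ω) (θ.symm^[N ω] ω) (J ω) (J (θ.symm^[N ω] ω))

/-- The points `ω` at which the pull-back times that matter are at most `M`, and at which the
escape probability is at least `ε / (M + 1)` for all `ε ≤ 1 / (M + 1)`. Only rational `ε` are
asked for, which makes the set measurable. -/
def desyncSet (X : ℝ → MRN k θ μ) (J : Ω → Fin k) (N : Ω → ℕ) (M : ℕ) : Set Ω :=
  {ω | N ω ≤ M ∧ N (θ.symm^[N ω] ω) ≤ M ∧ ∀ ε : ℚ, 0 ≤ ε → (ε : ℝ) ≤ 1 / (M + 1) →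
    1 / (M + 1) * (ε : ℝ) ≤ escapeProb (X ε) J N ω}

lemma measurable_symm_iterate {N : Ω → ℕ} (hN : Measurable N) :
    Measurable fun ω => θ.symm^[N ω] ω :=
  (measurable_from_prod_countable_right (f := fun p : ℕ × Ω => θ.symm^[p.1] p.2)
    fun n => θ.symm.measurable.iterate n).comp (hN.prodMk measurable_id)

lemma measurable_escapeProb (Y : MRN k θ μ) {J : Ω → Fin k} {N : Ω → ℕ} (hJ : Measurable J)
    (hN : Measurable N) : Measurable (escapeProb Y J N) := by
  have hback := measurable_symm_iterate (θ := θ) hN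
  have htrans : Measurable fun p : (ℕ × Fin k × Fin k) × Ω => Y.trans p.1.1 p.2 p.1.2.1 p.1.2.2 :=
    measurable_from_prod_countable_right fun q => Y.measurable_trans q.1 q.2.1 q.2.2
  exact measurable_const.sub
    (htrans.comp ((hN.prodMk (hJ.prodMk (hJ.comp hback))).prodMk hback))

lemma measurableSet_desyncSet (X : ℝ → MRN k θ μ) {J : Ω → Fin k} {N : Ω → ℕ}
    (hJ : Measurable J) (hN : Measurable N) (M : ℕ) : MeasurableSet (desyncSet X J N M) := by
  have hback := measurable_symm_iterate (θ := θ) hN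
  have h1 : MeasurableSet {ω | N ω ≤ M} := measurableSet_le hN measurable_const
  have h2 : MeasurableSet {ω | N (θ.symm^[N ω] ω) ≤ M} :=
    measurableSet_le (hN.comp hback) measurable_const
  have h3 : MeasurableSet (⋂ (ε : ℚ) (_ : 0 ≤ ε) (_ : (ε : ℝ) ≤ 1 / (M + 1)),
      {ω | 1 / (M + 1) * (ε : ℝ) ≤ escapeProb (X ε) J N ω}) :=
    .iInter fun ε => .iInter fun _ => .iInter fun _ =>
      measurableSet_le measurable_const (measurable_escapeProb _ hJ hN)
  convert h1.inter (h2.inter h3) using 1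
  ext ω
  simp [desyncSet]

lemma monotone_desyncSet (X : ℝ → MRN k θ μ) (J : Ω → Fin k) (N : Ω → ℕ) :
    Monotone (desyncSet X J N) := by
  intro M M' hM ω hω
  have hle : 1 / ((M' : ℝ) + 1) ≤ 1 / (M + 1) :=
    one_div_le_one_div_of_le (by positivity) (by exact_mod_cast Nat.succ_le_succ hM)
  refine ⟨hω.1.trans hM, hω.2.1.trans hM, fun ε h0 h1 => ?_⟩
  exact (mul_le_mul_of_nonneg_right hle (by exact_mod_cast h0)).trans
    (hω.2.2 ε h0 (h1.trans hle))

section Regular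

variable {X : ℝ → MRN k θ μ} {X₀ : MRN k θ μ} {J : Ω → Fin k} {N : Ω → ℕ} {ε₀ : ℝ} {ω : Ω}

namespace IsRegularOrbit

lemma trans_le_escapeProb (h : IsRegularOrbit X X₀ J N ε₀ ω) {ε : ℝ} (hε : 0 ≤ ε) {i : Fin k}
    (hi : i ≠ J ω) : (X ε).trans (N ω) (θ.symm^[N ω] ω) i (J (θ.symm^[N ω] ω)) ≤
      escapeProb (X ε) J N ω := by
  have hs := ((h.symm_iterate (N ω)).markovAlong hε).sum_trans (N ω) (J (θ.symm^[N ω] ω))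
  rw [escapeProb, le_sub_iff_add_le, ← hs, ← Finset.sum_pair hi
    (f := fun i => (X ε).trans (N ω) (θ.symm^[N ω] ω) i (J (θ.symm^[N ω] ω)))]
  exact Finset.sum_le_sum_of_subset_of_nonneg (Finset.subset_univ _)
    fun i _ _ => trans_nonneg _ _ _ _ _

variable [MeasurableSingletonClass Ω]

lemma le_escapeProb (h : IsRegularOrbit X X₀ J N ε₀ ω) {M : ℕ} (hM : ω ∈ desyncSet X J N M)
    {ε : ℝ} (h0 : 0 ≤ ε) (h1 : ε < ε₀) (h2 : ε < 1 / (M + 1)) :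
    1 / (M + 1) * ε ≤ escapeProb (X ε) J N ω := by
  by_contra! hlt
  -- by continuity the inequality fails at some rational number to the right of `ε` as well
  have hcont : ContinuousWithinAt (fun ε => escapeProb (X ε) J N ω - 1 / (M + 1) * ε)
      (Icc 0 ε₀) ε :=
    ((continuousOn_const.sub ((h.symm_iterate (N ω)).continuousOn_trans (N ω) _ _)).sub
      (continuousOn_const.mul continuousOn_id)) ε ⟨h0, h1.le⟩
  have hev : ContinuousWithinAt _ (Ioi ε) ε := hcont.mono_of_mem_nhdsWithin
    (mem_of_superset (Ioc_mem_nhdsGT h1) fun x hx => ⟨h0.trans hx.1.le, hx.2⟩)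
  obtain ⟨b, hb, hsub⟩ := mem_nhdsGT_iff_exists_Ioo_subset.1
    (hev.eventually (gt_mem_nhds (sub_neg.2 hlt)))
  obtain ⟨q, hq1, hq2⟩ := exists_rat_btwn (lt_min hb h2)
  have hq : escapeProb (X q) J N ω - 1 / (M + 1) * q < 0 :=
    hsub ⟨hq1, hq2.trans_le (min_le_left _ _)⟩
  have := hM.2.2 q (by exact_mod_cast h0.trans hq1.le) (hq2.le.trans (min_le_right _ _))
  linarith

lemma hasDerivWithinAt_escapeProb (h : IsRegularOrbit X X₀ J N ε₀ ω) (hε₀ : 0 < ε₀) :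
    HasDerivWithinAt (fun ε => escapeProb (X ε) J N ω) (-firstCoeff X J N ω (J ω)) (Ici 0) 0 := by
  rw [firstCoeff, Matrix.mulVec_single_one, Matrix.col_apply]
  exact ((h.symm_iterate (N ω)).hasDerivWithinAt_trans hε₀ (N ω) _ _).const_sub 1

lemma escapeProb_zero (h : IsRegularOrbit X X₀ J N ε₀ ω) : escapeProb (X 0) J N ω = 0 := by
  rw [escapeProb, (h.symm_iterate (N ω)).trans_zero_eq,
    h.regular.pullback _ (N ω) le_rfl (J ω), if_pos rfl, sub_self]

/-- The escape probability is of order `ε` exactly where the first-order coefficient does not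
vanish. -/
lemma exists_mem_desyncSet_iff (h : IsRegularOrbit X X₀ J N ε₀ ω) (hε₀ : 0 < ε₀) :
    (∃ M, ω ∈ desyncSet X J N M) ↔ firstCoeff X J N ω ≠ 0 := by
  constructor
  · rintro ⟨M, hM⟩ h0
    have hd := h.hasDerivWithinAt_escapeProb hε₀
    rw [h0, Pi.zero_apply, neg_zero] at hd
    have ht := (hasDerivWithinAt_iff_tendsto_slope' self_notMem_Ioi).1
      (hasDerivWithinAt_Ioi_iff_Ici.2 hd)
    have hpos : (0 : ℝ) < 1 / (M + 1) := by positivity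
    refine hpos.not_ge (ge_of_tendsto ht ?_)
    filter_upwards [Ioo_mem_nhdsGT (lt_min hε₀ hpos)] with ε hε
    rw [slope_def_field, h.escapeProb_zero, sub_zero, sub_zero, le_div_iff₀ hε.1]
    exact h.le_escapeProb hM hε.1.le (hε.2.trans_le (min_le_left _ _))
      (hε.2.trans_le (min_le_right _ _))
  · intro hne
    obtain ⟨i, hi⟩ := Function.ne_iff.1 hne
    -- a function of `ε` below the escape probability, with nonzero slope at `0`
    obtain ⟨r, hr, hrle⟩ : ∃ r : ℝ, 0 < r ∧ ∀ ε : ℝ, 0 ≤ ε → ε ≤ r →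
        r * ε ≤ escapeProb (X ε) J N ω := by
      by_cases hiJ : i = J ω
      · subst hiJ
        exact (h.hasDerivWithinAt_escapeProb hε₀).exists_pos_mul_le h.escapeProb_zero
          (fun ε hε => sub_nonneg.2 (trans_le_one _ _ _ _ _)) (neg_ne_zero.2 hi)
      · have h' := h.symm_iterate (N ω)
        rw [firstCoeff, Matrix.mulVec_single_one, Matrix.col_apply] at hi
        obtain ⟨r, hr, hrle⟩ := (h'.hasDerivWithinAt_trans hε₀ (N ω) i
          (J (θ.symm^[N ω] ω))).exists_pos_mul_le
          (by rw [h'.trans_zero_eq, h.regular.pullback _ (N ω) le_rfl i, if_neg hiJ])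
          (fun ε hε => trans_nonneg _ _ _ _ _) hi
        exact ⟨r, hr, fun ε h0 h1 => (hrle ε h0 h1).trans (h.trans_le_escapeProb h0 hiJ)⟩
    obtain ⟨m, hm⟩ := exists_nat_one_div_lt hr
    refine ⟨max m (max (N ω) (N (θ.symm^[N ω] ω))), by simp, by simp, fun ε h0 h1 => ?_⟩
    have hle : 1 / (((max m (max (N ω) (N (θ.symm^[N ω] ω))) : ℕ) : ℝ) + 1) ≤ r := by
      refine le_trans (one_div_le_one_div_of_le (by positivity) ?_) hm.le
      exact_mod_cast Nat.succ_le_succ (le_max_left _ _)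
    exact (mul_le_mul_of_nonneg_right hle (by exact_mod_cast h0)).trans
      (hrle ε (by exact_mod_cast h0) (h1.trans hle))

/-- At a time `n` with pull-back time at most `M`, any initial distribution has been synchronized up
to a probability `M ε`: only the last `M` steps matter. -/
lemma one_sub_le_trans_mulVec (h : IsRegularOrbit X X₀ J N ε₀ ω) {M n : ℕ} (hn : M ≤ n)
    (hM : N (θ^[n] ω) ≤ M) {ε : ℝ} (hε : 0 ≤ ε) {u : Fin k → ℝ}
    (hu : u ∈ stdSimplex ℝ (Fin k)) :
    1 - M * ε ≤ ((X ε).trans n ω *ᵥ u) (J (θ^[n] ω)) := by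
  have hadd := (h.markovAlong hε).trans_add M (n - M)
  rw [Nat.add_sub_cancel' hn, ← symm_iterate_iterate_of_le hn] at hadd
  rw [hadd, ← Matrix.mulVec_mulVec]
  exact le_mulVec_of_forall_le ((h.markovAlong hε).trans_mulVec_mem _ hu)
    fun l => (h.iterate n).one_sub_le_trans_index hM hε l

/-- Any initial distribution puts mass at least `(1 - M ε) f(ε)` outside of the synchronized state,
where `f` is the escape probability: it is nearly synchronized by the time at which the escape
probability starts to count, and twice `M` steps suffice for this. -/
lemma trans_mulVec_le (h : IsRegularOrbit X X₀ J N ε₀ ω) {M n : ℕ} (hn : 2 * M ≤ n)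
    (hM : θ^[n] ω ∈ desyncSet X J N M) {ε : ℝ} (h0 : 0 ≤ ε) {u : Fin k → ℝ}
    (hu : u ∈ stdSimplex ℝ (Fin k)) :
    ((X ε).trans n ω *ᵥ u) (J (θ^[n] ω)) ≤
      1 - (1 - M * ε) * escapeProb (X ε) J N (θ^[n] ω) := by
  obtain ⟨hM1, hM2, -⟩ := hM
  set m := N (θ^[n] ω) with hm
  have hmn : m ≤ n := by omega
  have hadd := (h.markovAlong h0).trans_add m (n - m)
  rw [Nat.add_sub_cancel' hmn] at hadd
  rw [symm_iterate_iterate_of_le hmn] at hM2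
  rw [hadd, ← Matrix.mulVec_mulVec]
  refine (mulVec_le_one_sub ((h.markovAlong h0).trans_mulVec_mem _ hu)
    (fun l => trans_le_one _ _ _ _ _) (J (θ^[n - m] ω))).trans ?_
  have h1 := h.one_sub_le_trans_mulVec (n := n - m) (M := M) (by omega) hM2 h0 hu
  have h2 : escapeProb (X ε) J N (θ^[n] ω) =
      1 - (X ε).trans m (θ^[n - m] ω) (J (θ^[n] ω)) (J (θ^[n - m] ω)) := by
    rw [escapeProb, ← hm, symm_iterate_iterate_of_le hmn]
  rw [h2]
  exact sub_le_sub_left (mul_le_mul_of_nonneg_right h1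
    (sub_nonneg.2 (trans_le_one _ _ _ _ _))) 1

/-- Synchronization at the times at which the pull-back time is at most `M`, and
desynchronization at the times at which the orbit is in `desyncSet X J N M`. -/
lemma sync_and_desync (h : IsRegularOrbit X X₀ J N ε₀ ω) {M : ℕ} {ε : ℝ} (h0 : 0 ≤ ε)
    (h1 : ε < min ε₀ (1 / (2 * (M + 1)))) {W : Type w} [MeasurableSpace W] {Q : Measure W}
    [IsProbabilityMeasure Q] {ξ η : ℕ → W → Fin k × Ω} (hξ : IsCopyOver (X ε) ω Q ξ)
    (hη : IsCopyOver (X ε) ω Q η)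
    (hind : IndepFun (fun w n => ξ n w) (fun w n => η n w) Q) :
    (∀ n, M ≤ n → N (θ^[n] ω) ≤ M →
      1 - ε * (2 * (M + 1)) ≤ Q.real {w | ξ n w = η n w}) ∧
    (∀ n, 2 * M ≤ n → θ^[n] ω ∈ desyncSet X J N M →
      ε * (1 / (4 * (M + 1))) ≤ Q.real {w | ξ n w ≠ η n w}) := by
  obtain ⟨u, hu, hu'⟩ := hξ.exists_measureReal_eq
  obtain ⟨v, hv, hv'⟩ := hη.exists_measureReal_eq
  have hM0 : (0 : ℝ) ≤ M := M.cast_nonneg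
  constructor
  · intro n hn hM
    have h2 := h.one_sub_le_trans_mulVec hn hM h0 hu
    have h3 := h.one_sub_le_trans_mulVec hn hM h0 hv
    rw [← hu'] at h2
    rw [← hv'] at h3
    have h4 := le_measureReal_eq hind n (J (θ^[n] ω), θ^[n] ω)
    nlinarith
  · intro n hn hM
    have h2 := h.trans_mulVec_le hn hM h0 hu
    have h3 := h.one_sub_le_trans_mulVec (by omega) hM.1 h0 hv
    rw [← hu'] at h2
    rw [← hv'] at h3
    have hε1 : ε < 1 / (2 * (M + 1)) := h1.trans_le (min_le_right _ _)
    have hε2 : ε < 1 / (M + 1) := hε1.trans_le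
      (one_div_le_one_div_of_le (by positivity) (by linarith))
    have hhalf : 1 / 2 ≤ 1 - M * ε := by
      rw [lt_div_iff₀ (by positivity)] at hε1
      nlinarith
    have h4 := (h.iterate n).le_escapeProb hM h0 (h1.trans_le (min_le_left _ _)) hε2
    have h5 := le_measureReal_ne hξ.1 hind n (J (θ^[n] ω), θ^[n] ω)
    refine le_trans ?_ h5
    have h6 : 1 / 2 * (1 / (M + 1) * ε) ≤ 1 - Q.real {w | ξ n w = (J (θ^[n] ω), θ^[n] ω)} :=
      (mul_le_mul hhalf h4 (by positivity) (by linarith)).trans (by linarith)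
    calc ε * (1 / (4 * (M + 1))) = 1 / 2 * (1 / (M + 1) * ε) * (1 / 2) := by
          field_simp; norm_num
      _ ≤ _ := mul_le_mul h6 (hhalf.trans h3) (by norm_num) (le_trans (by positivity) h6)

end IsRegularOrbit

end Regular

/-! ### The alternating pattern -/

/-- The times of a set of density `τ` at which the orbit visits `A` have density at least
`τ + μ A - 1`; finitely many of them may be left out. -/
lemma ae_lt_lowerDensity [IsProbabilityMeasure μ] (hθ : Ergodic θ μ) {T : Set ℕ} {τ K : ℝ}
    (hT : ∀ n : ℕ, τ * n - K ≤ ((T ∩ Icc 1 n).ncard : ℝ)) {A : Set Ω} (hA : MeasurableSet A)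
    (m : ℕ) {c : ℝ} (hc : c < τ + μ.real A - 1) :
    ∀ᵐ ω ∂μ, c < lowerDensity (T ∩ {t | θ^[t] ω ∈ A} ∩ Ici m) := by
  obtain ⟨c', hc1, hc2⟩ := exists_between hc
  filter_upwards [hθ.ae_exists_le_ncard_visits hA (c := c' - τ + 1) (by linarith)] with ω ⟨K', hK'⟩
  refine lt_lowerDensity (K := K + K' + m) hc1 fun n => ?_
  have h1 := add_ncard_sub_le_ncard_inter T {t | θ^[t] ω ∈ A} n
  have h2 := add_ncard_sub_le_ncard_inter (T ∩ {t | θ^[t] ω ∈ A}) (Ici m) n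
  have h3 := sub_le_ncard_Ici m n
  have h4 := hT n
  have h5 := hK' n
  linarith

/-- The alternating pattern is produced by sets of times `TE`, `TF` with densities `τE`, `τF`, if
synchronization is observed at the times in `TE` at which the orbit is in `A`, and
desynchronization at the times in `TF` at which it is in the union of the sets `desyncSet`. -/
theorem hasAlternatingPattern_of_times [MeasurableSingletonClass Ω] [IsProbabilityMeasure μ]
    (hθ : Ergodic θ μ) {X : ℝ → MRN k θ μ} {X₀ : MRN k θ μ} {J : Ω → Fin k} {N : Ω → ℕ} {ε₀ : ℝ}
    (hε₀ : 0 < ε₀) (hJ : Measurable J) (hN : Measurable N)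
    (hreg : ∀ᵐ ω ∂μ, IsRegularOrbit X X₀ J N ε₀ ω) {TE TF : Set ℕ} {τE τF KE KF : ℝ}
    (hTE : ∀ n : ℕ, τE * n - KE ≤ ((TE ∩ Icc 1 n).ncard : ℝ))
    (hTF : ∀ n : ℕ, τF * n - KF ≤ ((TF ∩ Icc 1 n).ncard : ℝ)) {A : Set Ω}
    (hA : MeasurableSet A) (hdisj : Disjoint TE TF ∨ Disjoint A (⋃ M, desyncSet X J N M))
    {a : ℝ} (ha0 : 0 < a) (ha1 : a < 1) (haE : a ≤ τE + μ.real A - 1)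
    (haF : 1 - a ≤ τF + μ.real (⋃ M, desyncSet X J N M) - 1) :
    HasAlternatingPattern.{u, w} X a 1 := by
  refine ⟨min a (1 - a), lt_min ha0 (by linarith), fun δ hδ0 hδ1 => ?_⟩
  have hmono : Monotone fun M => {ω | N ω ≤ M} ∩ A := fun M M' hM ω hω =>
    ⟨le_trans (show N ω ≤ M from hω.1) hM, hω.2⟩
  have hunion : ⋃ M, ({ω | N ω ≤ M} ∩ A) = A := by
    ext ω
    simp only [mem_iUnion, mem_inter_iff, mem_ofPred_eq, exists_and_right, and_iff_right_iff_imp]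
    exact fun _ => ⟨N ω, le_rfl⟩
  obtain ⟨M₁, hM₁⟩ := exists_forall_ge_lt_measureReal (μ := μ) hmono (c := a - δ - τE + 1)
    (by rw [hunion]; linarith)
  obtain ⟨M₂, hM₂⟩ := exists_forall_ge_lt_measureReal (μ := μ) (monotone_desyncSet X J N)
    (c := 1 - a - δ - τF + 1) (by linarith)
  set M := max M₁ M₂
  have hE := hM₁ M (le_max_left _ _)
  have hF := hM₂ M (le_max_right _ _)
  refine ⟨min ε₀ (1 / (2 * (M + 1))), 2 * (M + 1), 1 / (4 * (M + 1)),
    lt_min hε₀ (by positivity), by positivity, by positivity,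
    fun ω => TE ∩ {t | θ^[t] ω ∈ {ω | N ω ≤ M} ∩ A} ∩ Ici (2 * M),
    fun ω => TF ∩ {t | θ^[t] ω ∈ desyncSet X J N M} ∩ Ici (2 * M), ?_⟩
  filter_upwards [hreg, ae_lt_lowerDensity hθ hTE
    ((measurableSet_le hN measurable_const).inter hA) (2 * M) (c := a - δ) (by linarith),
    ae_lt_lowerDensity hθ hTF (measurableSet_desyncSet X hJ hN M) (2 * M) (c := 1 - a - δ)
    (by linarith)] with ω hω hdE hdF
  have hδa := hδ1.trans_le (min_le_left _ _)
  have hδa' := hδ1.trans_le (min_le_right _ _)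
  refine ⟨⟨?_, by linarith, by linarith, hdE, hdF⟩, ?_⟩
  · refine disjoint_left.2 fun t ht ht' => ?_
    rcases hdisj with hdisj | hdisj
    · exact disjoint_left.1 hdisj ht.1.1 ht'.1.1
    · exact disjoint_left.1 hdisj ht.1.2.2 (mem_iUnion.2 ⟨M, ht'.1.2⟩)
  · intro ε h0 h1 W _ Q _ ξ η hξ hη hind
    obtain ⟨hs, hd⟩ := hω.sync_and_desync h0 h1 hξ hη hind
    simp only [pow_one]
    refine ⟨fun n hn => hs n ?_ hn.1.2.1, fun n hn => hd n hn.2 hn.1.2⟩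
    have : 2 * M ≤ n := hn.2
    omega

end MRN

/-! ### Pull-back synchronization -/

namespace MRN

section Existence

variable {Ω : Type u} [MeasurableSpace Ω] {k : ℕ} {θ : Ω ≃ᵐ Ω} {μ : Measure Ω}

/-- The points `ω` that the network reaches in the state `i`, from whatever state it starts at
time `-n`. -/
def pullbackSyncSet (X : MRN k θ μ) (n : ℕ) (i : Fin k) : Set Ω :=
  {ω | ∀ j, X.trans n (θ.symm^[n] ω) i j = 1}

lemma measurableSet_pullbackSyncSet (X : MRN k θ μ) (n : ℕ) (i : Fin k) :
    MeasurableSet (pullbackSyncSet X n i) := by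
  have : pullbackSyncSet X n i = ⋂ j, {ω | X.trans n (θ.symm^[n] ω) i j = 1} := by
    ext ω
    simp [pullbackSyncSet]
  rw [this]
  exact .iInter fun j => ((X.measurable_trans n i j).comp (θ.symm.measurable.iterate n))
    (measurableSet_singleton 1)

lemma MarkovAlong.trans_stateMap {X : MRN k θ μ} {ω : Ω} (h : X.MarkovAlong ω) {n : ℕ} {j : Fin k}
    (hdet : ∀ i, X.trans n ω i j = 0 ∨ X.trans n ω i j = 1) :
    X.trans n ω (X.stateMap n ω j) j = 1 := by
  have hex := h.exists_trans_eq_one hdet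
  rw [stateMap, dif_pos hex]
  exact hex.choose_spec

variable [MeasurableSingletonClass Ω]

lemma mem_pullbackSyncSet_of_le {X : MRN k θ μ} {ω : Ω} (h : ∀ m, X.MarkovAlong (θ.symm^[m] ω))
    {m n : ℕ} (hmn : m ≤ n) {i : Fin k} (hm : ω ∈ pullbackSyncSet X m i) :
    ω ∈ pullbackSyncSet X n i := by
  intro j
  have hω : θ^[n - m] (θ.symm^[n] ω) = θ.symm^[m] ω := by
    conv_lhs => rw [← Nat.sub_add_cancel hmn, Function.iterate_add_apply, Nat.add_sub_cancel,
      iterate_symm_iterate]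
  have hadd := (h n).trans_add m (n - m)
  rw [Nat.add_sub_cancel' hmn, hω] at hadd
  rw [hadd, Matrix.mul_apply]
  simp only [show ∀ l, X.trans m (θ.symm^[m] ω) i l = 1 from hm, one_mul]
  exact (h n).sum_trans _ j

lemma eq_of_mem_pullbackSyncSet {X : MRN k θ μ} {ω : Ω} (h : ∀ m, X.MarkovAlong (θ.symm^[m] ω))
    {m n : ℕ} {i i' : Fin k} (hm : ω ∈ pullbackSyncSet X m i)
    (hn : ω ∈ pullbackSyncSet X n i') : i = i' := by
  have h1 := mem_pullbackSyncSet_of_le h (le_max_left m n) hm i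
  have h2 := mem_pullbackSyncSet_of_le h (le_max_right m n) hn i
  rw [(h _).trans_eq_ite h2] at h1
  by_contra hne
  rw [if_neg hne] at h1
  exact zero_ne_one h1

lemma iterate_mem_pullbackSyncSet {X : MRN k θ μ} {ω : Ω}
    (h : ∀ m, X.MarkovAlong (θ.symm^[m] ω)) {m n : ℕ} {i i' : Fin k}
    (hm : ω ∈ pullbackSyncSet X m i) (hi : X.trans n ω i' i = 1) :
    θ^[n] ω ∈ pullbackSyncSet X (n + m) i' := by
  intro j
  have hω : θ.symm^[n + m] (θ^[n] ω) = θ.symm^[m] ω := by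
    rw [Nat.add_comm, Function.iterate_add_apply, symm_iterate_iterate]
  rw [hω, (h m).trans_add n m, iterate_symm_iterate, Matrix.mul_apply]
  simp [(h m).trans_eq_ite (hm j), hi]

/-- A synchronized deterministic network synchronizes in the pull-back sense: the set where this
happens has positive measure and is mapped into itself, so it has full measure. -/
lemma ae_exists_mem_pullbackSyncSet (hk : 0 < k) (hθ : Ergodic θ μ) [IsProbabilityMeasure μ]
    {X : MRN k θ μ} (hdet : X.IsDeterministic) (hsync : X.IsSynchronized)
    (hmarkov : ∀ᵐ ω ∂μ, ∀ m, X.MarkovAlong (θ.symm^[m] ω)) :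
    ∀ᵐ ω ∂μ, ∃ m i, ω ∈ pullbackSyncSet X m i := by
  obtain ⟨N, -, hN⟩ := hsync
  set G : Set Ω := ⋃ (m) (i), pullbackSyncSet X m i with hG
  have hGm : MeasurableSet G :=
    .iUnion fun m => .iUnion fun i => measurableSet_pullbackSyncSet X m i
  have hinv : G ≤ᵐ[μ] θ ⁻¹' G := by
    filter_upwards [hmarkov, hdet] with ω hω hd hGω
    obtain ⟨m, i, hmi⟩ := mem_iUnion₂.1 hGω
    obtain ⟨i', hi'⟩ := (hω 0).exists_trans_eq_one (fun i' => hd 1 i' i)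
    exact mem_iUnion₂.2 ⟨1 + m, i', iterate_mem_pullbackSyncSet hω hmi hi'⟩
  rcases hθ.ae_empty_or_univ_of_ae_le_preimage' hGm.nullMeasurableSet hinv
    (measure_ne_top μ G) with h | h
  · exfalso
    have hnull : ∀ m i, μ {ω | ∀ j, X.trans m ω i j = 1} = 0 := by
      intro m i
      have h1 : μ (pullbackSyncSet X m i) = 0 :=
        measure_mono_null (subset_iUnion₂ (s := fun m i => pullbackSyncSet X m i) m i)
          (ae_eq_empty.1 h)
      have h2 := (hθ.toMeasurePreserving.iterate m).quasiMeasurePreserving.preimage_null h1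
      convert h2 using 2
      ext ω
      change _ ↔ ∀ j, X.trans m (θ.symm^[m] (θ^[m] ω)) i j = 1
      rw [symm_iterate_iterate]
      rfl
    have hU : μ (⋃ (m) (i), {ω | ∀ j, X.trans m ω i j = 1}) = 0 :=
      measure_iUnion_null fun m => measure_iUnion_null fun i => hnull m i
    have hfull : ∀ᵐ ω ∂μ, ω ∈ ⋃ (m) (i), {ω | ∀ j, X.trans m ω i j = 1} := by
      filter_upwards [hmarkov, hdet, hN] with ω hω hd hs
      refine mem_iUnion₂.2 ⟨N ω, X.stateMap (N ω) ω ⟨0, hk⟩, fun j => ?_⟩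
      rw [hs ⟨0, hk⟩ j (N ω) le_rfl]
      exact (hω 0).trans_stateMap fun i => hd _ i j
    have hfalse : ∀ᵐ _ω ∂μ, False := by
      filter_upwards [hfull, measure_eq_zero_iff_ae_notMem.1 hU] with ω h1 h2 using h2 h1
    exact hfalse.exists.choose_spec
  · filter_upwards [h.mem_iff] with ω hω
    simpa [hG] using hω.2 (mem_univ ω)

/-- A synchronized deterministic network has a synchronization index and a pull-back
synchronization time. -/
theorem exists_isSyncIndex_isPullbackSyncTime (hk : 0 < k) (hθ : Ergodic θ μ)
    [IsProbabilityMeasure μ] {X : MRN k θ μ} (hdet : X.IsDeterministic)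
    (hsync : X.IsSynchronized) :
    ∃ (J : Ω → Fin k) (N : Ω → ℕ), X.IsSyncIndex J ∧ X.IsPullbackSyncTime J N := by
  classical
  have hmarkov : ∀ᵐ ω ∂μ, ∀ m, X.MarkovAlong (θ.symm^[m] ω) := by
    filter_upwards [ae_forall_orbit hθ.toMeasurePreserving X.ae_isMarkovAt] with ω hω m t
      using hω m t
  -- a pair `(n, i)` is encoded as the number `n * k + i`
  let S : ℕ → Set Ω := fun c => pullbackSyncSet X (c / k) ⟨c % k, Nat.mod_lt c hk⟩
  have hSm : ∀ c, MeasurableSet (S c) := fun c => measurableSet_pullbackSyncSet X _ _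
  have hp : ∀ ω, ∃ c, ω ∈ S c ∨ ω ∈ (⋃ c, S c)ᶜ := by
    intro ω
    by_cases hω : ω ∈ ⋃ c, S c
    · obtain ⟨c, hc⟩ := mem_iUnion.1 hω
      exact ⟨c, .inl hc⟩
    · exact ⟨0, .inr hω⟩
  have hcode : Measurable fun ω => Nat.find (hp ω) :=
    measurable_find hp fun c => (hSm c).union (MeasurableSet.iUnion hSm).compl
  set code : Ω → ℕ := fun ω => Nat.find (hp ω) with hcode_def
  set J : Ω → Fin k := fun ω => ⟨code ω % k, Nat.mod_lt _ hk⟩ with hJ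
  set N : Ω → ℕ := fun ω => code ω / k with hN
  have hmem : ∀ᵐ ω ∂μ, ω ∈ pullbackSyncSet X (N ω) (J ω) := by
    filter_upwards [ae_exists_mem_pullbackSyncSet hk hθ hdet hsync hmarkov] with ω ⟨m, i, hmi⟩
    have hc : ω ∈ S (m * k + i) := by
      have h1 : (m * k + i) / k = m := by
        rw [Nat.mul_comm, Nat.mul_add_div hk, Nat.div_eq_of_lt i.2, Nat.add_zero]
      have h2 : (⟨(m * k + i) % k, Nat.mod_lt _ hk⟩ : Fin k) = i :=
        Fin.ext (by simp [Nat.mod_eq_of_lt i.2])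
      change ω ∈ pullbackSyncSet X _ _
      rw [h1, h2]
      exact hmi
    exact (Nat.find_spec (hp ω)).resolve_right fun hn => hn (mem_iUnion.2 ⟨_, hc⟩)
  have horbit := ae_forall_orbit hθ.toMeasurePreserving hmem
  refine ⟨J, N, ⟨(measurable_from_top (f := fun c : ℕ => (⟨c % k, Nat.mod_lt _ hk⟩ : Fin k))).comp
    hcode, ?_⟩, (measurable_from_top (f := fun c : ℕ => c / k)).comp hcode, ?_⟩
  · filter_upwards [ae_forall_orbit hθ.toMeasurePreserving hmarkov, hdet, horbit]
      with ω hω hd ho n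
    obtain ⟨i', hi'⟩ := (hω 0 0 0).exists_trans_eq_one (fun i' => hd n i' (J ω))
    have h1 := iterate_mem_pullbackSyncSet (hω 0 0) (ho 0 0) hi'
    have h2 : i' = J (θ^[n] ω) := eq_of_mem_pullbackSyncSet (hω 0 n) h1 (ho 0 n)
    ext i
    rw [Matrix.mulVec_single_one, Matrix.col_apply, Pi.single_apply, ← h2]
    exact (hω 0 0 0).trans_eq_ite hi' i
  · filter_upwards [hmarkov, hmem] with ω hω hm j n hn
    have h1 := mem_pullbackSyncSet_of_le hω hn hm j
    ext i
    rw [Matrix.mulVec_single_one, Matrix.col_apply, Pi.single_apply]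
    exact (hω n).trans_eq_ite h1 i

end Existence

end MRN

/-! ### First-order alternation -/

theorem mainTheorem7 {Ω : Type u} [MeasurableSpace Ω] [MeasurableSingletonClass Ω]
    (μ : Measure Ω) [IsProbabilityMeasure μ] (θ : Ω ≃ᵐ Ω) (hθ : Ergodic θ μ)
    (k : ℕ) (hk : 2 ≤ k) (m : ℕ) (hm : 1 ≤ m)
    (X₀ : MRN k θ μ) (hdet : X₀.IsDeterministic) (hsync : X₀.IsSynchronized)
    (X : ℝ → MRN k θ μ) (hX : MRN.IsMarkovPerturbation X X₀)
    (hXm : MRN.IsSmoothPerturbation X m) :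
    (∃ (J : Ω → Fin k) (N : Ω → ℕ), X₀.IsSyncIndex J ∧ X₀.IsPullbackSyncTime J N) ∧
    ∀ (J : Ω → Fin k) (N : Ω → ℕ), X₀.IsSyncIndex J → X₀.IsPullbackSyncTime J N →
      μ {ω | MRN.dissipation X J (θ.symm ω) = 0} < 1 →
      (0 < μ (MRN.degenerateSet X J N) →
        μ (MRN.degenerateSet X J N) < 1 ∧
        MRN.HasAlternatingPattern.{u, w} X (μ.real (MRN.degenerateSet X J N)) 1) ∧
      (μ (MRN.degenerateSet X J N) = 0 →
        ∀ a : ℝ, 0 < a → a < 1 → MRN.HasAlternatingPattern.{u, w} X a 1) := by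
  refine ⟨MRN.exists_isSyncIndex_isPullbackSyncTime (by omega) hθ hdet hsync, ?_⟩
  intro J N hJ hN hd
  obtain ⟨ε₀, hε₀, hsmooth⟩ := hXm
  have hreg := MRN.ae_isRegularOrbit hθ.toMeasurePreserving hm hsmooth hdet hX hJ hN
  set D : Set Ω := ⋃ M, MRN.desyncSet X J N M with hD
  have hDm : MeasurableSet D :=
    .iUnion fun M => MRN.measurableSet_desyncSet X hJ.1 hN.1 M
  have hDeg : ∀ᵐ ω ∂μ, ω ∈ MRN.degenerateSet X J N ↔ ω ∈ Dᶜ := by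
    filter_upwards [hreg] with ω hω
    rw [mem_compl_iff, hD, mem_iUnion, hω.exists_mem_desyncSet_iff hε₀, not_not]
    rfl
  have hmeas : μ (MRN.degenerateSet X J N) = μ Dᶜ := measure_congr (eventuallyEq_set.2 hDeg)
  have hreal : μ.real (MRN.degenerateSet X J N) = μ.real Dᶜ := congrArg ENNReal.toReal hmeas
  have hcompl : μ.real Dᶜ = 1 - μ.real D := probReal_compl_eq_one_sub hDm
  refine ⟨fun hpos => ?_, fun hnull a ha0 ha1 => ?_⟩
  · have hlt : μ (MRN.degenerateSet X J N) < 1 := by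
      refine lt_of_le_of_ne prob_le_one fun h1 => hd.ne ?_
      have hq : ∀ᵐ ω ∂μ, MRN.firstCoeff X J N ω = 0 := by
        rw [hmeas, ← mem_ae_iff_prob_eq_one hDm.compl] at h1
        filter_upwards [h1, hDeg] with ω h2 h3 using h3.2 h2
      have hs : MeasurePreserving θ.symm μ μ := hθ.toMeasurePreserving.symm θ
      have hall : ∀ᵐ ω ∂μ, MRN.dissipation X J (θ.symm ω) = 0 := by
        refine hs.quasiMeasurePreserving.ae (p := fun ω => MRN.dissipation X J ω = 0) ?_
        filter_upwards [hreg, hq, hθ.quasiMeasurePreserving.ae hq] with ω h2 h3 h4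
          using h2.dissipation_eq_zero hε₀ h3 h4
      have huniv : {ω | MRN.dissipation X J (θ.symm ω) = 0} =ᵐ[μ] univ :=
        eventuallyEq_univ.2 hall
      rw [measure_congr huniv, measure_univ]
    refine ⟨hlt, ?_⟩
    have ha0 : 0 < μ.real (MRN.degenerateSet X J N) :=
      ENNReal.toReal_pos hpos.ne' (measure_ne_top _ _)
    have ha1 : μ.real (MRN.degenerateSet X J N) < 1 := by
      have := (ENNReal.toReal_lt_toReal (measure_ne_top _ _) ENNReal.one_ne_top).2 hlt
      rwa [ENNReal.toReal_one] at this
    have hT : ∀ n : ℕ, (1 : ℝ) * n - 0 ≤ ((univ ∩ Icc 1 n).ncard : ℝ) := fun n => by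
      simp [← Finset.coe_Icc, ncard_coe_finset]
    refine MRN.hasAlternatingPattern_of_times hθ hε₀ hJ.1 hN.1 hreg hT hT hDm.compl
      (.inr disjoint_compl_left) ha0 ha1 (by linarith) ?_
    rw [← hD]
    linarith
  · have h0 : μ.real D = 1 := by
      have : μ.real (MRN.degenerateSet X J N) = 0 := by rw [measureReal_def, hnull]; rfl
      linarith
    -- the orbit need not separate the two kinds of times, so a set of times of density `a` is
    -- prescribed
    refine MRN.hasAlternatingPattern_of_times hθ hε₀ hJ.1 hN.1 hreg
      (MRN.le_ncard_beattySet ha0.le ha1) (MRN.le_ncard_compl_beattySet ha0.le ha1)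
      MeasurableSet.univ (.inl disjoint_compl_right) ha0 ha1 (by simp) ?_
    rw [← hD, h0]
    linarith
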